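/- **Setting.** Let $n,m_1,m_2,N,d_1,d_2$ be natural numbers with $0<d_2<d_1<N+1$ and let $\delta>0$. For $i=1,2$ let $A,\bar A,Q_i,H_i\in\mathbb R^{n\times n}$, $B_i,\bar B_i\in\mathbb R^{n\times m_i}$, and let $R_i\in\mathbb R^{m_i\times m_i}$ be positive definite. A prime denotes the transpose. Put $$B_{1i}=-B_iR_i^{-1}B_i',\quad B_{2i}=-B_iR_i^{-1}\bar B_i',\quad \bar B_{1i}=-\bar B_iR_i^{-1}B_i',\quad \bar B_{2i}=-\bar B_iR_i^{-1}\bar B_i',$$ $$\hat A=I+\delta A,\quad \hat B_{li}=\delta B_{li},\quad \hat Q_i=\delta Q_i .$$ Let $\Delta w_0,\dots,\Delta w_N$ be independent real random variables with mean $0$ and variance $\delta$, and let $x_0$ be an $\mathbb R^n$-valued random variable (for instance a constant) independent of $(\Delta w_0,\dots,\Delta w_N)$. For an integer $j\le N$ let $\hat{\mathbb E}_j$ be the conditional expectation given $\sigma(x_0,\Delta w_0,\dots,\Delta w_j)$, which is $\sigma(x_0)$ if $j<0$. Put $A_k=\hat A+\Delta w_k\bar A$ and $B_{li,k}=\hat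 B_{li}+\Delta w_k\bar B_{li}$. Let $(x_k)_{0\le k\le N+1}$ and $(p_{i,k})_{0\le k\le N}$, $i=1,2$, be square-integrable $\mathbb R^n$-valued random variables that start from the given $x_0$ and satisfy, almost surely, $$x_{k+1}=A_kx_k+B_{11,k}\hat{\mathbb E}_{k-d_1-1}(p_{1,k})+B_{12,k}\hat{\mathbb E}_{k-d_2-1}(p_{2,k})+\tfrac1\delta B_{21,k}\hat{\mathbb E}_{k-d_1-1}(\Delta w_kp_{1,k})+\tfrac1\delta B_{22,k}\hat{\mathbb E}_{k-d_2-1}(\Delta w_kp_{2,k})\quad(0\le k\le N),$$ $$p_{i,k-1}=\hat{\mathbb E}_{k-1}(A_k'p_{i,k})+\hat Q_ix_k\quad(1\le k\le N),\qquad p_{i,N}=H_ix_{N+1}.$$ **Coefficients.** For $n\times n$ matrices $\hat P_{i,k}$, $\hat P_{i,k}^{k+j}$ $(0\le j<d_1)$, $\check P_{i,k}^{k+j}$ $(0\le j<d_2)$, with $d_1\le k\le N+1$, put $$S^m_{i,k}=\hat P_{i,k}+\sum_{j=m-1}^{d_1-1}\hat P_{i,k}^{k+j}+\sum_{j=0}^{d_2-1}\check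 P_{i,k}^{k+j}\ (m\ge1),\qquad \hat S_{i,k}=S^1_{i,k},\qquad \check S_{i,k}=S^{d_1-d_2}_{i,k},$$ $$\hat\Gamma_k=\begin{bmatrix}I-\hat B_{11}\hat S_{1,k}-\hat B_{12}\hat S_{2,k}&-\frac1\delta(\hat B_{21}\hat P_{1,k}+\hat B_{22}\hat P_{2,k})\\-\delta(\bar B_{11}\hat S_{1,k}+\bar B_{12}\hat S_{2,k})&I-\bar B_{21}\hat P_{1,k}-\bar B_{22}\hat P_{2,k}\end{bmatrix},\qquad \Gamma_k^m=\begin{bmatrix}I-\hat B_{12}S^m_{2,k}&-\frac1\delta\hat B_{22}\hat P_{2,k}\\-\delta\bar B_{12}S^m_{2,k}&I-\bar B_{22}\hat P_{2,k}\end{bmatrix},$$ $$\check\Gamma_k=\Gamma_k^{d_1-d_2},\qquad G_k=\begin{bmatrix}\hat B_{11}\hat S_{1,k}&\frac1\delta\hat B_{21}\hat P_{1,k}\\\delta\bar B_{11}\hat S_{1,k}&\bar B_{21}\hat P_{1,k}\end{bmatrix},\qquad a=\begin{bmatrix}\hat A\\\delta\bar A\end{bmatrix},\qquad \mathcal B=\begin{bmatrix}\hat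 B_{12}&0\\\delta\bar B_{12}&0\end{bmatrix},$$ and, for $1\le m\le d_1-d_2-1$, $$K_k(m)=\begin{bmatrix}\hat P_{2,k}^{k+m-1}&0\\0&\hat P_{2,k}^{k+m-1}\end{bmatrix}(\Gamma_k^m)^{-1},\qquad Z_k(m)=(I+K_k(d_1-d_2-1)\mathcal B)\cdots(I+K_k(m+1)\mathcal B)$$ (indices decreasing from left to right, $Z_k(d_1-d_2-1)=I$). With the block rows $$L_{1,k-1}=\big[B_{11,k-1}\hat S_{1,k}\ \ \tfrac1\delta B_{21,k-1}\hat P_{1,k}\big],\quad L_{2,k-1}=\big[B_{12,k-1}\check S_{2,k}\ \ \tfrac1\delta B_{22,k-1}\hat P_{2,k}\big],\quad L_{3,k-1}=[B_{12,k-1}\ \ 0]+L_{2,k-1}\check\Gamma_k^{-1}\mathcal B,$$ put $$M_{k-1}=\Big\{L_{1,k-1}+L_{2,k-1}\check\Gamma_k^{-1}G_k+L_{3,k-1}\Big[\sum_{j=1}^{d_1-d_2-1}Z_k(j)K_k(j)\Big]G_k\Big\}\hat\Gamma_k^{-1}a,$$ $$M^m_{k-1}=L_{3,k-1}Z_k(m)K_k(m)\,a\quad(1\le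 m\le d_1-d_2-1),\qquad \mathcal H_{k-1}=L_{2,k-1}\check\Gamma_k^{-1}a .$$ **Riccati recursions.** For $i=1,2$: $\hat P_{i,N+1}=H_i$, $\hat P_{i,N+1}^{s}=\check P_{i,N+1}^{s}=0$ for $s>N$, and for $d_1\le k\le N$ $$\hat P_{i,k}=\hat A'\hat P_{i,k+1}\hat A+\delta\bar A'\hat P_{i,k+1}\bar A+\hat A'(\hat P_{i,k+1}^{k+d_1}+\check P_{i,k+1}^{k+d_2})\hat A+\hat Q_i,$$ $$\hat P_{i,k}^{k}=\mathbb E\big[(\hat A'\hat S_{i,k+1}+\Delta w_k\bar A'\hat P_{i,k+1})M_k\big],\qquad \check P_{i,k}^{k}=\mathbb E\big[(\hat A'\check S_{i,k+1}+\Delta w_k\bar A'\hat P_{i,k+1})\mathcal H_k\big],$$ $$\hat P_{i,k}^{k+m}=\mathbb E\Big[(\hat A'S^{m+1}_{i,k+1}+\Delta w_k\bar A'\hat P_{i,k+1})M_k^m+\hat A'\hat P_{i,k+1}^{k+m}\Big(\hat A+\mathcal H_k+\sum_{j=m}^{d_1-d_2-1}M_k^j\Big)\Big]\quad(0<m<d_1-d_2),$$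 $$\hat P_{i,k}^{k+m}=\hat A'\hat P_{i,k+1}^{k+m}\hat A\quad(d_1-d_2\le m<d_1),\qquad \check P_{i,k}^{k+m}=\hat A'\check P_{i,k+1}^{k+m}\hat A\quad(0<m<d_2).$$ **Lemma 3.4.** Assume that the Riccati recursions admit a solution such that, for $d_1\le k\le N+1$, the matrices $\hat\Gamma_k$, $\Gamma_k^m$ $(1\le m\le d_1-d_2-1)$ and $\check\Gamma_k$ are invertible. Then for every $k$ with $d_1\le k\le N+1$, almost surely, $$x_k=A_{k-1}x_{k-1}+M_{k-1}\hat{\mathbb E}_{k-d_1-2}(x_{k-1})+\sum_{m=1}^{d_1-d_2-1}M^m_{k-1}\hat{\mathbb E}_{k-d_1-2+m}(x_{k-1})+\mathcal H_{k-1}\hat{\mathbb E}_{k-d_2-2}(x_{k-1}),$$ and for $i=1,2$ $$p_{i,k-1}=\hat P_{i,k}x_k+\sum_{j=0}^{d_1-1}\hat P_{i,k}^{k+j}\hat{\mathbb E}_{k-d_1-1+j}(x_k)+\sum_{j=0}^{d_2-1}\check P_{i,k}^{k+j}\hat{\mathbb E}_{k-d_2-1+j}(x_k).$$ -/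

import Mathlib

open MeasureTheory ProbabilityTheory
open scoped Matrix

noncomputable section

/-- Data of the linear-quadratic game with delayed information, on a grid of `N + 1` steps of
length `δ`; the delays of the two players are `d₁ * δ` and `d₂ * δ`. A bar is written `b`;
the weights `Q`, `H` of player 1 and 2 are `Q 0`, `H 0` and `Q 1`, `H 1`. -/
structure DelayGame (n m₁ m₂ : ℕ) where
  A : Matrix (Fin n) (Fin n) ℝ
  Ab : Matrix (Fin n) (Fin n) ℝ
  B₁ : Matrix (Fin n) (Fin m₁) ℝ
  Bb₁ : Matrix (Fin n) (Fin m₁) ℝ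
  B₂ : Matrix (Fin n) (Fin m₂) ℝ
  Bb₂ : Matrix (Fin n) (Fin m₂) ℝ
  R₁ : Matrix (Fin m₁) (Fin m₁) ℝ
  R₂ : Matrix (Fin m₂) (Fin m₂) ℝ
  Q : Fin 2 → Matrix (Fin n) (Fin n) ℝ
  H : Fin 2 → Matrix (Fin n) (Fin n) ℝ
  δ : ℝ
  d₁ : ℕ
  d₂ : ℕ
  N : ℕ

/-- Candidate solution of the backward Riccati recursions:
`P i k`, `Ph i k s`, `Pc i k s` stand for `P̂_{i,k}`, `P̂_{i,k}^s`, `P̌_{i,k}^s`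
(player 1 is `i = 0`, player 2 is `i = 1`). -/
structure RiccatiFamily (n : ℕ) where
  P : Fin 2 → ℕ → Matrix (Fin n) (Fin n) ℝ
  Ph : Fin 2 → ℕ → ℕ → Matrix (Fin n) (Fin n) ℝ
  Pc : Fin 2 → ℕ → ℕ → Matrix (Fin n) (Fin n) ℝ

/-- Expectation of a random matrix, entry by entry. -/
def matExp {Ω : Type*} [MeasurableSpace Ω] (μ : Measure Ω) {a b : Type*}
    (F : Ω → Matrix a b ℝ) : Matrix a b ℝ :=
  Matrix.of fun r c => ∫ ω, F ω r c ∂μ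

/-- The information at step `j`: the σ-algebra generated by the initial value `ξ` and the
increments `dw 0, …, dw j`. For `j < 0` no increment is known, and a deterministic `ξ`
contributes nothing. -/
@[reducible] def info {Ω : Type*} {n : ℕ} (ξ : Ω → Fin n → ℝ) (dw : ℕ → Ω → ℝ) (j : ℤ) :
    MeasurableSpace Ω :=
  MeasurableSpace.comap ξ inferInstance ⊔
    ⨆ (i : ℕ) (_ : (i : ℤ) ≤ j), MeasurableSpace.comap (dw i) inferInstance

/-- The increments `dw 0, …, dw N` are independent, centred, of variance `δ`, and independent of
the initial value `ξ`. -/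
structure IsNoise {Ω : Type*} [MeasurableSpace Ω] (μ : Measure Ω) {n : ℕ} (δ : ℝ) (N : ℕ)
    (ξ : Ω → Fin n → ℝ) (dw : ℕ → Ω → ℝ) : Prop where
  measurable_init : Measurable ξ
  measurable : ∀ k ≤ N, Measurable (dw k)
  memLp : ∀ k ≤ N, MemLp (dw k) 2 μ
  mean : ∀ k ≤ N, ∫ ω, dw k ω ∂μ = 0
  variance : ∀ k ≤ N, ∫ ω, dw k ω ^ 2 ∂μ = δ
  indep : iIndepFun (fun (i : Fin (N + 1)) => dw i) μ
  indep_init : IndepFun ξ (fun ω (i : Fin (N + 1)) => dw i ω) μ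

namespace DelayGame

variable {n m₁ m₂ : ℕ} (D : DelayGame n m₁ m₂)

/-! Coefficients of the Hamiltonian system after elimination of the controls. -/

def B11 : Matrix (Fin n) (Fin n) ℝ := -(D.B₁ * D.R₁⁻¹ * D.B₁ᵀ)
def B12 : Matrix (Fin n) (Fin n) ℝ := -(D.B₂ * D.R₂⁻¹ * D.B₂ᵀ)
def B21 : Matrix (Fin n) (Fin n) ℝ := -(D.B₁ * D.R₁⁻¹ * D.Bb₁ᵀ)
def B22 : Matrix (Fin n) (Fin n) ℝ := -(D.B₂ * D.R₂⁻¹ * D.Bb₂ᵀ)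
def Bb11 : Matrix (Fin n) (Fin n) ℝ := -(D.Bb₁ * D.R₁⁻¹ * D.B₁ᵀ)
def Bb12 : Matrix (Fin n) (Fin n) ℝ := -(D.Bb₂ * D.R₂⁻¹ * D.B₂ᵀ)
def Bb21 : Matrix (Fin n) (Fin n) ℝ := -(D.Bb₁ * D.R₁⁻¹ * D.Bb₁ᵀ)
def Bb22 : Matrix (Fin n) (Fin n) ℝ := -(D.Bb₂ * D.R₂⁻¹ * D.Bb₂ᵀ)

/-! Hatted (time-scaled) coefficients, and the random coefficients `A_k`, `B_{ij,k}` as functions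
of the value `z` of the increment `dw k`. -/

def Ah : Matrix (Fin n) (Fin n) ℝ := 1 + D.δ • D.A
def Bh11 : Matrix (Fin n) (Fin n) ℝ := D.δ • D.B11
def Bh12 : Matrix (Fin n) (Fin n) ℝ := D.δ • D.B12
def Bh21 : Matrix (Fin n) (Fin n) ℝ := D.δ • D.B21
def Bh22 : Matrix (Fin n) (Fin n) ℝ := D.δ • D.B22
def Qh (i : Fin 2) : Matrix (Fin n) (Fin n) ℝ := D.δ • D.Q i

def rA (z : ℝ) : Matrix (Fin n) (Fin n) ℝ := D.Ah + z • D.Ab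
def rB11 (z : ℝ) : Matrix (Fin n) (Fin n) ℝ := D.Bh11 + z • D.Bb11
def rB12 (z : ℝ) : Matrix (Fin n) (Fin n) ℝ := D.Bh12 + z • D.Bb12
def rB21 (z : ℝ) : Matrix (Fin n) (Fin n) ℝ := D.Bh21 + z • D.Bb21
def rB22 (z : ℝ) : Matrix (Fin n) (Fin n) ℝ := D.Bh22 + z • D.Bb22

/-- Square-integrable solution `(x_k)_{k ≤ N+1}`, `(p_{i,k})_{k ≤ N}` of the discretized delayed
forward-backward equations with initial value `ξ`. -/
structure IsSolution {Ω : Type*} [MeasurableSpace Ω] (μ : Measure Ω)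
    (ξ : Ω → Fin n → ℝ) (dw : ℕ → Ω → ℝ)
    (x : ℕ → Ω → Fin n → ℝ) (p : Fin 2 → ℕ → Ω → Fin n → ℝ) : Prop where
  memLp_x : ∀ k ≤ D.N + 1, MemLp (x k) 2 μ
  memLp_p : ∀ i, ∀ k ≤ D.N, MemLp (p i k) 2 μ
  init : x 0 =ᵐ[μ] ξ
  forward : ∀ k ≤ D.N, ∀ᵐ ω ∂μ, x (k + 1) ω =
    D.rA (dw k ω) *ᵥ x k ω
      + D.rB11 (dw k ω) *ᵥ (μ[p 0 k | info ξ dw ((k : ℤ) - D.d₁ - 1)]) ω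
      + D.rB12 (dw k ω) *ᵥ (μ[p 1 k | info ξ dw ((k : ℤ) - D.d₂ - 1)]) ω
      + (1 / D.δ) • (D.rB21 (dw k ω) *ᵥ
          (μ[fun ω' => dw k ω' • p 0 k ω' | info ξ dw ((k : ℤ) - D.d₁ - 1)]) ω)
      + (1 / D.δ) • (D.rB22 (dw k ω) *ᵥ
          (μ[fun ω' => dw k ω' • p 1 k ω' | info ξ dw ((k : ℤ) - D.d₂ - 1)]) ω)
  backward : ∀ i, ∀ k, 1 ≤ k → k ≤ D.N → ∀ᵐ ω ∂μ, p i (k - 1) ω =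
    (μ[fun ω' => (D.rA (dw k ω'))ᵀ *ᵥ p i k ω' | info ξ dw ((k : ℤ) - 1)]) ω
      + D.Qh i *ᵥ x k ω
  terminal : ∀ i, ∀ᵐ ω ∂μ, p i D.N ω = D.H i *ᵥ x (D.N + 1) ω

variable (S : RiccatiFamily n)

/-- `P̂_{i,k} + ∑_{l ≤ j < d₁} P̂_{i,k}^{k+j} + ∑_{0 ≤ j < d₂} P̌_{i,k}^{k+j}`. -/
def partialS (i : Fin 2) (k l : ℕ) : Matrix (Fin n) (Fin n) ℝ :=
  S.P i k + ∑ j ∈ Finset.Ico l D.d₁, S.Ph i k (k + j)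
    + ∑ j ∈ Finset.range D.d₂, S.Pc i k (k + j)

/-- `Ŝ_{i,k}`. -/
def Sh (i : Fin 2) (k : ℕ) : Matrix (Fin n) (Fin n) ℝ := D.partialS S i k 0

/-- `S_{i,k}^m`, for `m ≥ 1`. -/
def Sm (i : Fin 2) (k m : ℕ) : Matrix (Fin n) (Fin n) ℝ := D.partialS S i k (m - 1)

/-- `Š_{i,k}`. -/
def Sc (i : Fin 2) (k : ℕ) : Matrix (Fin n) (Fin n) ℝ := D.partialS S i k (D.d₁ - D.d₂ - 1)

/-- `Γ̂_k`. -/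
def Gammah (k : ℕ) : Matrix (Fin n ⊕ Fin n) (Fin n ⊕ Fin n) ℝ :=
  Matrix.fromBlocks
    (1 - D.Bh11 * D.Sh S 0 k - D.Bh12 * D.Sh S 1 k)
    (-((1 / D.δ) • (D.Bh21 * S.P 0 k + D.Bh22 * S.P 1 k)))
    (-(D.δ • (D.Bb11 * D.Sh S 0 k + D.Bb12 * D.Sh S 1 k)))
    (1 - D.Bb21 * S.P 0 k - D.Bb22 * S.P 1 k)

/-- `Γ_k^m`, for `m ≥ 1`. -/
def Gamma (k m : ℕ) : Matrix (Fin n ⊕ Fin n) (Fin n ⊕ Fin n) ℝ :=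
  Matrix.fromBlocks
    (1 - D.Bh12 * D.Sm S 1 k m)
    (-((1 / D.δ) • (D.Bh22 * S.P 1 k)))
    (-(D.δ • (D.Bb12 * D.Sm S 1 k m)))
    (1 - D.Bb22 * S.P 1 k)

/-- `Γ̌_k`. -/
def Gammac (k : ℕ) : Matrix (Fin n ⊕ Fin n) (Fin n ⊕ Fin n) ℝ :=
  Matrix.fromBlocks
    (1 - D.Bh12 * D.Sc S 1 k)
    (-((1 / D.δ) • (D.Bh22 * S.P 1 k)))
    (-(D.δ • (D.Bb12 * D.Sc S 1 k)))
    (1 - D.Bb22 * S.P 1 k)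

/-- `G_k`. -/
def G (k : ℕ) : Matrix (Fin n ⊕ Fin n) (Fin n ⊕ Fin n) ℝ :=
  Matrix.fromBlocks
    (D.Bh11 * D.Sh S 0 k)
    ((1 / D.δ) • (D.Bh21 * S.P 0 k))
    (D.δ • (D.Bb11 * D.Sh S 0 k))
    (D.Bb21 * S.P 0 k)

/-- The block column `[Â; δ Ā]`. -/
def colA : Matrix (Fin n ⊕ Fin n) (Fin n) ℝ := Matrix.fromRows D.Ah (D.δ • D.Ab)

/-- The block matrix `[B̂₁₂ 0; δ B̄₁₂ 0]`. -/
def blockB : Matrix (Fin n ⊕ Fin n) (Fin n ⊕ Fin n) ℝ :=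
  Matrix.fromBlocks D.Bh12 0 (D.δ • D.Bb12) 0

/-- `P̂_{2,k}^{k+m-1} (Γ_k^m)⁻¹`, where the first factor acts on both blocks. -/
def K (k m : ℕ) : Matrix (Fin n ⊕ Fin n) (Fin n ⊕ Fin n) ℝ :=
  Matrix.fromBlocks (S.Ph 1 k (k + m - 1)) 0 0 (S.Ph 1 k (k + m - 1)) * (D.Gamma S k m)⁻¹

/-- `(I + K_k(m+r) B) ⋯ (I + K_k(m+1) B)`, where `B` is `blockB`. -/
def Zprod (k m : ℕ) : ℕ → Matrix (Fin n ⊕ Fin n) (Fin n ⊕ Fin n) ℝ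
  | 0 => 1
  | r + 1 => (1 + D.K S k (m + r + 1) * D.blockB) * Zprod k m r

/-- `Z_k(m) = (I + K_k(d₁-d₂-1) B) ⋯ (I + K_k(m+1) B)`, for `1 ≤ m ≤ d₁ - d₂ - 1`;
the product is `I` if `m = d₁ - d₂ - 1`. -/
def Z (k m : ℕ) : Matrix (Fin n ⊕ Fin n) (Fin n ⊕ Fin n) ℝ :=
  D.Zprod S k m (D.d₁ - D.d₂ - 1 - m)

/-- The block row `[B_{11,k} Ŝ_{1,k+1}   δ⁻¹ B_{21,k} P̂_{1,k+1}]` at noise value `z`. -/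
def row1 (k : ℕ) (z : ℝ) : Matrix (Fin n) (Fin n ⊕ Fin n) ℝ :=
  Matrix.fromCols (D.rB11 z * D.Sh S 0 (k + 1)) ((1 / D.δ) • (D.rB21 z * S.P 0 (k + 1)))

/-- The block row `[B_{12,k} Š_{2,k+1}   δ⁻¹ B_{22,k} P̂_{2,k+1}]` at noise value `z`. -/
def row2 (k : ℕ) (z : ℝ) : Matrix (Fin n) (Fin n ⊕ Fin n) ℝ :=
  Matrix.fromCols (D.rB12 z * D.Sc S 1 (k + 1)) ((1 / D.δ) • (D.rB22 z * S.P 1 (k + 1)))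

/-- The bracket `[B_{12,k} 0] + [B_{12,k} Š_{2,k+1}   δ⁻¹ B_{22,k} P̂_{2,k+1}] Γ̌_{k+1}⁻¹ B`. -/
def bracket (k : ℕ) (z : ℝ) : Matrix (Fin n) (Fin n ⊕ Fin n) ℝ :=
  Matrix.fromCols (D.rB12 z) 0 + D.row2 S k z * (D.Gammac S (k + 1))⁻¹ * D.blockB

/-- `M_k` at noise value `z`. -/
def M (k : ℕ) (z : ℝ) : Matrix (Fin n) (Fin n) ℝ :=
  (D.row1 S k z
    + D.row2 S k z * (D.Gammac S (k + 1))⁻¹ * D.G S (k + 1)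
    + D.bracket S k z
        * (∑ j ∈ Finset.Icc 1 (D.d₁ - D.d₂ - 1), D.Z S (k + 1) j * D.K S (k + 1) j)
        * D.G S (k + 1))
    * (D.Gammah S (k + 1))⁻¹ * D.colA

/-- `M_k^m` at noise value `z`; it is `0` unless `m < d₁ - d₂`. -/
def Mm (k m : ℕ) (z : ℝ) : Matrix (Fin n) (Fin n) ℝ :=
  if m < D.d₁ - D.d₂ then
    D.bracket S k z * D.Z S (k + 1) m * D.K S (k + 1) m * D.colA
  else 0

/-- `H_k` (the coefficient, not the terminal weight) at noise value `z`. -/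
def Hm (k : ℕ) (z : ℝ) : Matrix (Fin n) (Fin n) ℝ :=
  D.row2 S k z * (D.Gammac S (k + 1))⁻¹ * D.colA

/-- `S` solves the backward Riccati recursions for `d₁ ≤ k ≤ N`, with terminal values at
`k = N + 1`. -/
structure IsRiccati {Ω : Type*} [MeasurableSpace Ω] (μ : Measure Ω) (dw : ℕ → Ω → ℝ) :
    Prop where
  terminal : ∀ i, S.P i (D.N + 1) = D.H i
  terminal_Ph : ∀ i s, D.N < s → S.Ph i (D.N + 1) s = 0
  terminal_Pc : ∀ i s, D.N < s → S.Pc i (D.N + 1) s = 0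
  eq_P : ∀ i k, D.d₁ ≤ k → k ≤ D.N →
    S.P i k = D.Ahᵀ * S.P i (k + 1) * D.Ah + D.δ • (D.Abᵀ * S.P i (k + 1) * D.Ab)
      + D.Ahᵀ * (S.Ph i (k + 1) (k + D.d₁) + S.Pc i (k + 1) (k + D.d₂)) * D.Ah + D.Qh i
  eq_Ph_zero : ∀ i k, D.d₁ ≤ k → k ≤ D.N →
    S.Ph i k k = matExp μ fun ω =>
      (D.Ahᵀ * D.Sh S i (k + 1) + dw k ω • (D.Abᵀ * S.P i (k + 1))) * D.M S k (dw k ω)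
  eq_Ph_small : ∀ i k m, D.d₁ ≤ k → k ≤ D.N → 0 < m → m < D.d₁ - D.d₂ →
    S.Ph i k (k + m) = matExp μ fun ω =>
      (D.Ahᵀ * D.Sm S i (k + 1) (m + 1) + dw k ω • (D.Abᵀ * S.P i (k + 1)))
          * D.Mm S k m (dw k ω)
        + D.Ahᵀ * S.Ph i (k + 1) (k + m)
          * (D.Ah + D.Hm S k (dw k ω)
            + ∑ j ∈ Finset.Icc m (D.d₁ - D.d₂ - 1), D.Mm S k j (dw k ω))
  eq_Ph_large : ∀ i k m, D.d₁ ≤ k → k ≤ D.N → D.d₁ - D.d₂ ≤ m → m < D.d₁ →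
    S.Ph i k (k + m) = D.Ahᵀ * S.Ph i (k + 1) (k + m) * D.Ah
  eq_Pc_zero : ∀ i k, D.d₁ ≤ k → k ≤ D.N →
    S.Pc i k k = matExp μ fun ω =>
      (D.Ahᵀ * D.Sc S i (k + 1) + dw k ω • (D.Abᵀ * S.P i (k + 1))) * D.Hm S k (dw k ω)
  eq_Pc : ∀ i k m, D.d₁ ≤ k → k ≤ D.N → 0 < m → m < D.d₂ →
    S.Pc i k (k + m) = D.Ahᵀ * S.Pc i (k + 1) (k + m) * D.Ah

end DelayGame

end

/-! The proof is a backward induction on `κ` that carries the feedback formula for `p i κ`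
(`HasFeedback`). It starts from the terminal condition, where all coefficients of estimates vanish.

Two facts drive each step. The increment `dw κ` is independent of the information at `κ - 1`
(`IsNoise.isFresh`), so under conditioning on that or earlier information a coefficient affine or
quadratic in `dw κ`, applied to a vector known at `κ - 1`, is replaced by its mean
(`IsFresh.hasCondExp_mulVec`). The information is nested, so an estimate of an estimate is the
estimate with the smaller index (`min_lag`).

With the feedback formula inserted, the forward equation becomes implicit: its right side contains
estimates of `x (κ + 1)` and of `dw κ • x (κ + 1)`. Conditioning the equation, and its product with
`dw κ`, at the indices `r = 0, …, d₁ - d₂` gives a linear system for the pairs `Y r` of these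
estimates (`HasFeedback.block_system`). It is triangular: `Y r` is coupled only to itself and to `Y
j` with `j < r`. The diagonal blocks are `Gammah` at `0`, `Gamma` in between and `Gammac` at `d₁ -
d₂`, so invertibility permits forward substitution (`closedLoop_of_system`), whose propagation is
recorded by the products `Z`. The outcome is the closed loop for `x (κ + 1)`.

The closed loop and the feedback formula, inserted into the backward equation, express `p i (κ - 1)`
through estimates of `x κ`. The Riccati recursions are the comparison of coefficients
(`collect_estimates`, `HasFeedback.backward`). The estimate with index `d₁` is `x κ` itself, which
is why the last delayed coefficients enter the recursion for `P`. -/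

noncomputable section

/-! ### Calculus of versions of conditional expectations -/

/-- `f` is integrable and `g` is a version of its conditional expectation given `m`. -/
def HasCondExp {Ω E : Type*} [NormedAddCommGroup E] [NormedSpace ℝ E] [CompleteSpace E]
    (m : MeasurableSpace Ω) {mΩ : MeasurableSpace Ω} (μ : Measure Ω) (f g : Ω → E) : Prop :=
  Integrable f μ ∧ μ[f | m] =ᵐ[μ] g

namespace HasCondExp

variable {Ω E : Type*} [NormedAddCommGroup E] [NormedSpace ℝ E] [CompleteSpace E]
  {m m' mΩ : MeasurableSpace Ω} {μ : Measure Ω}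

theorem refl {f : Ω → E} (hf : Integrable f μ) : HasCondExp m μ f (μ[f | m]) :=
  ⟨hf, Filter.EventuallyEq.rfl⟩

theorem congr {f f' g g' : Ω → E} (h : HasCondExp m μ f g) (hf : f' =ᵐ[μ] f)
    (hg : g =ᵐ[μ] g') : HasCondExp m μ f' g' :=
  ⟨h.1.congr hf.symm, (condExp_congr_ae hf).trans (h.2.trans hg)⟩

theorem add {f f' g g' : Ω → E} (h : HasCondExp m μ f g) (h' : HasCondExp m μ f' g') :
    HasCondExp m μ (fun ω => f ω + f' ω) (fun ω => g ω + g' ω) :=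
  ⟨h.1.add h'.1, (condExp_add h.1 h'.1 m).trans (h.2.add h'.2)⟩

theorem smul {f g : Ω → E} (c : ℝ) (h : HasCondExp m μ f g) :
    HasCondExp m μ (fun ω => c • f ω) (fun ω => c • g ω) :=
  ⟨h.1.smul c, (condExp_smul c f m).trans (h.2.const_smul c)⟩

theorem sum {ι : Type*} (s : Finset ι) {f g : ι → Ω → E}
    (h : ∀ i ∈ s, HasCondExp m μ (f i) (g i)) :
    HasCondExp m μ (fun ω => ∑ i ∈ s, f i ω) (fun ω => ∑ i ∈ s, g i ω) := by
  have e : (fun ω => ∑ i ∈ s, f i ω) = ∑ i ∈ s, f i := by ext ω; simp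
  rw [e]
  refine ⟨integrable_finsetSum' _ fun i hi => (h i hi).1,
    (condExp_finsetSum (fun i hi => (h i hi).1) m).trans ?_⟩
  have : ∀ᵐ ω ∂μ, ∀ i ∈ s, (μ[f i | m]) ω = g i ω :=
    (Filter.eventually_all_finset s).2 fun i hi => (h i hi).2
  filter_upwards [this] with ω hω
  rw [Finset.sum_apply]
  exact Finset.sum_congr rfl hω

theorem mulVec {a b : Type*} [Fintype a] [Fintype b] (C : Matrix a b ℝ) {f g : Ω → b → ℝ}
    (h : HasCondExp m μ f g) : HasCondExp m μ (fun ω => C *ᵥ f ω) (fun ω => C *ᵥ g ω) := by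
  set T := (Matrix.mulVecLin C).toContinuousLinearMap
  refine ⟨T.integrable_comp h.1, (T.comp_condExp_comm h.1).symm.trans ?_⟩
  filter_upwards [h.2] with ω hω
  simp [T, hω]

theorem of_aestronglyMeasurable [IsFiniteMeasure μ] (hm : m ≤ mΩ) {f : Ω → E}
    (hf : AEStronglyMeasurable[m] f μ) (hi : Integrable f μ) : HasCondExp m μ f f :=
  ⟨hi, condExp_of_aestronglyMeasurable' hm hf hi⟩

theorem condExp_of_le [IsFiniteMeasure μ] (hle : m ≤ m')
    (hm : m' ≤ mΩ) (f : Ω → E) : HasCondExp m μ (μ[f | m']) (μ[f | m]) :=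
  ⟨integrable_condExp, condExp_condExp_of_le hle hm⟩

theorem condExp_of_ge [IsFiniteMeasure μ] (hle : m' ≤ m)
    (hm : m ≤ mΩ) (f : Ω → E) : HasCondExp m μ (μ[f | m']) (μ[f | m']) :=
  of_aestronglyMeasurable hm (stronglyMeasurable_condExp.mono hle).aestronglyMeasurable
    integrable_condExp

end HasCondExp

/-! ### Matrix polynomials in the noise value -/

/-- Matrix-valued polynomials of degree at most one. -/
def IsAffine {a b : Type*} (F : ℝ → Matrix a b ℝ) : Prop :=
  ∃ C₀ C₁ : Matrix a b ℝ, ∀ z, F z = C₀ + z • C₁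

/-- Matrix-valued polynomials of degree at most two. -/
def IsQuadratic {a b : Type*} (F : ℝ → Matrix a b ℝ) : Prop :=
  ∃ C₀ C₁ C₂ : Matrix a b ℝ, ∀ z, F z = C₀ + z • C₁ + z ^ 2 • C₂

section Polynomials

variable {a b c : Type*}

theorem IsAffine.isQuadratic {F : ℝ → Matrix a b ℝ} (h : IsAffine F) : IsQuadratic F := by
  obtain ⟨C₀, C₁, h⟩ := h
  exact ⟨C₀, C₁, 0, fun z => by simp [h]⟩

theorem isAffine_const (C : Matrix a b ℝ) : IsAffine fun _ => C := ⟨C, 0, fun z => by simp⟩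

theorem IsAffine.add {F F' : ℝ → Matrix a b ℝ} (h : IsAffine F) (h' : IsAffine F') :
    IsAffine fun z => F z + F' z := by
  obtain ⟨C₀, C₁, h⟩ := h
  obtain ⟨D₀, D₁, h'⟩ := h'
  exact ⟨C₀ + D₀, C₁ + D₁, fun z => by simp only [h, h', smul_add]; abel⟩

theorem IsAffine.smul {F : ℝ → Matrix a b ℝ} (h : IsAffine F) (r : ℝ) :
    IsAffine fun z => r • F z := by
  obtain ⟨C₀, C₁, h⟩ := h
  exact ⟨r • C₀, r • C₁, fun z => by simp only [h, smul_add, smul_comm r z]⟩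

theorem IsAffine.mul_const [Fintype b] {F : ℝ → Matrix a b ℝ} (h : IsAffine F) (C : Matrix b c ℝ) :
    IsAffine fun z => F z * C := by
  obtain ⟨C₀, C₁, h⟩ := h
  exact ⟨C₀ * C, C₁ * C, fun z => by simp only [h, Matrix.add_mul, Matrix.smul_mul]⟩

theorem IsAffine.mul [Fintype b] {F : ℝ → Matrix a b ℝ} {F' : ℝ → Matrix b c ℝ} (h : IsAffine F)
    (h' : IsAffine F') : IsQuadratic fun z => F z * F' z := by
  obtain ⟨C₀, C₁, h⟩ := h
  obtain ⟨D₀, D₁, h'⟩ := h'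
  refine ⟨C₀ * D₀, C₀ * D₁ + C₁ * D₀, C₁ * D₁, fun z => ?_⟩
  simp only [h, h', Matrix.add_mul, Matrix.mul_add, Matrix.smul_mul, Matrix.mul_smul, smul_add, smul_smul,
    sq]
  abel

theorem IsAffine.smul_id {F : ℝ → Matrix a b ℝ} (h : IsAffine F) :
    IsQuadratic fun z => z • F z := by
  obtain ⟨C₀, C₁, h⟩ := h
  exact ⟨0, C₀, C₁, fun z => by simp only [h, smul_add, smul_smul, sq, zero_add]⟩

theorem IsAffine.fromCols {F : ℝ → Matrix a b ℝ} {F' : ℝ → Matrix a c ℝ} (h : IsAffine F)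
    (h' : IsAffine F') : IsAffine fun z => Matrix.fromCols (F z) (F' z) := by
  obtain ⟨C₀, C₁, h⟩ := h
  obtain ⟨D₀, D₁, h'⟩ := h'
  refine ⟨Matrix.fromCols C₀ D₀, Matrix.fromCols C₁ D₁, fun z => ?_⟩
  ext i (j | j) <;> simp [h, h']

theorem IsAffine.transpose {F : ℝ → Matrix a b ℝ} (h : IsAffine F) :
    IsAffine fun z => (F z)ᵀ := by
  obtain ⟨C₀, C₁, h⟩ := h
  exact ⟨C₀ᵀ, C₁ᵀ, fun z => by simp [h]⟩

end Polynomials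

/-! ### Conditional expectations involving an independent increment -/

/-- `w` is a centred random variable of variance `δ`, independent of the σ-algebra `m`. -/
structure IsFresh {Ω : Type*} (m : MeasurableSpace Ω) {mΩ : MeasurableSpace Ω} (μ : Measure Ω)
    (w : Ω → ℝ) (δ : ℝ) : Prop where
  le : m ≤ mΩ
  measurable : Measurable[mΩ] w
  memLp : MemLp w 2 μ
  mean : ∫ ω, w ω ∂μ = 0
  variance : ∫ ω, w ω ^ 2 ∂μ = δ
  indep : Indep (MeasurableSpace.comap w inferInstance) m μ

namespace IsFresh

variable {Ω : Type*} {m m' mΩ : MeasurableSpace Ω} {μ : Measure Ω}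
  {w : Ω → ℝ} {δ : ℝ}

theorem integrable [IsProbabilityMeasure μ] (h : IsFresh m μ w δ) : Integrable w μ := h.memLp.integrable (by norm_num)

theorem integrable_sq (h : IsFresh m μ w δ) : Integrable (fun ω => w ω ^ 2) μ :=
  h.memLp.integrable_sq

theorem matExp_quadratic [IsProbabilityMeasure μ] (h : IsFresh m μ w δ) {a b : Type*} (C₀ C₁ C₂ : Matrix a b ℝ) :
    matExp μ (fun ω => C₀ + w ω • C₁ + w ω ^ 2 • C₂) = C₀ + δ • C₂ := by
  ext r c
  have h1 : Integrable (fun ω => w ω * C₁ r c) μ := h.integrable.mul_const _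
  have h2 : Integrable (fun ω => w ω ^ 2 * C₂ r c) μ := h.integrable_sq.mul_const _
  simp only [matExp, Matrix.of_apply, Matrix.add_apply, Matrix.smul_apply, smul_eq_mul]
  have h0 : Integrable (fun ω => C₀ r c + w ω * C₁ r c) μ := (integrable_const _).add h1
  rw [integral_add h0 h2, integral_add (integrable_const _) h1,
    integral_mul_const, integral_mul_const, h.mean, h.variance]
  simp

theorem matExp_affine [IsProbabilityMeasure μ] (h : IsFresh m μ w δ) {a b : Type*} (C₀ C₁ : Matrix a b ℝ) :
    matExp μ (fun ω => C₀ + w ω • C₁) = C₀ := by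
  simpa using h.matExp_quadratic C₀ C₁ 0

theorem matExp_smul_affine [IsProbabilityMeasure μ] (h : IsFresh m μ w δ) {a b : Type*} (C₀ C₁ : Matrix a b ℝ) :
    matExp μ (fun ω => w ω • (C₀ + w ω • C₁)) = δ • C₁ := by
  simpa [smul_smul, sq] using h.matExp_quadratic 0 C₀ C₁

theorem matExp_add [IsProbabilityMeasure μ] (h : IsFresh m μ w δ) {a b : Type*} {F F' : ℝ → Matrix a b ℝ}
    (hF : IsQuadratic F) (hF' : IsQuadratic F') :
    matExp μ (fun ω => F (w ω) + F' (w ω)) =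
      matExp μ (fun ω => F (w ω)) + matExp μ (fun ω => F' (w ω)) := by
  obtain ⟨C₀, C₁, C₂, hF⟩ := hF
  obtain ⟨D₀, D₁, D₂, hF'⟩ := hF'
  have e : ∀ z, F z + F' z = (C₀ + D₀) + z • (C₁ + D₁) + z ^ 2 • (C₂ + D₂) := fun z => by
    rw [hF, hF', smul_add, smul_add]; abel
  simp only [e, h.matExp_quadratic]
  simp only [hF, hF', h.matExp_quadratic, smul_add]
  abel

theorem matExp_const_mul [IsProbabilityMeasure μ] (h : IsFresh m μ w δ) {a b c : Type*} [Fintype b] (C : Matrix a b ℝ)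
    {F : ℝ → Matrix b c ℝ} (hF : IsQuadratic F) :
    matExp μ (fun ω => C * F (w ω)) = C * matExp μ (fun ω => F (w ω)) := by
  obtain ⟨C₀, C₁, C₂, hF⟩ := hF
  simp only [hF, Matrix.mul_add, Matrix.mul_smul, h.matExp_quadratic]

/-- Conditioning first on the larger `m` pulls `v` out and turns `φ (w)` into its mean, by
independence; the tower property then descends to `m'`. Independence also makes the product
integrable, so `v` need not be square-integrable. -/
theorem hasCondExp_smul [IsProbabilityMeasure μ] (h : IsFresh m μ w δ) (hle : m' ≤ m) {E : Type*} [NormedAddCommGroup E]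
    [NormedSpace ℝ E] [CompleteSpace E] {φ : ℝ → ℝ} (hφ : Measurable φ)
    (hi : Integrable (fun ω => φ (w ω)) μ) {v : Ω → E} (hv : AEStronglyMeasurable[m] v μ)
    (hvi : Integrable v μ) :
    HasCondExp m' μ (fun ω => φ (w ω) • v ω) (fun ω => (∫ ω, φ (w ω) ∂μ) • (μ[v | m']) ω) := by
  obtain ⟨v', hv', hvv'⟩ := hv
  have hw : Measurable[MeasurableSpace.comap w inferInstance] fun ω => φ (w ω) :=
    hφ.comp (comap_measurable w)
  have hint : Integrable (fun ω => φ (w ω) • v ω) μ := by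
    borelize E
    have hind : IndepFun (fun ω => φ (w ω)) v' μ := by
      rw [IndepFun_iff_Indep]
      exact indep_of_indep_of_le_right (indep_of_indep_of_le_left h.indep hw.comap_le)
        hv'.measurable.comap_le
    refine (hind.integrable_smul hi (hvi.congr hvv')).congr ?_
    filter_upwards [hvv'] with ω hω
    rw [hω]
  refine ⟨hint, ?_⟩
  have h1 : μ[fun ω => φ (w ω) • v ω | m] =ᵐ[μ] fun ω => (∫ ω, φ (w ω) ∂μ) • v ω := by
    refine (condExp_smul_of_aestronglyMeasurable_right hi hint ⟨v', hv', hvv'⟩).trans ?_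
    filter_upwards [condExp_indep_eq h.measurable.comap_le h.le hw.stronglyMeasurable h.indep]
      with ω hω
    simp [hω]
  exact (condExp_condExp_of_le hle h.le).symm.trans
    ((condExp_congr_ae h1).trans (condExp_smul _ v m'))

theorem hasCondExp_smul_self [IsProbabilityMeasure μ] (h : IsFresh m μ w δ) (hle : m' ≤ m) {E : Type*}
    [NormedAddCommGroup E] [NormedSpace ℝ E] [CompleteSpace E] {v : Ω → E}
    (hv : AEStronglyMeasurable[m] v μ) (hvi : Integrable v μ) :
    HasCondExp m' μ (fun ω => w ω • v ω) (fun _ => 0) := by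
  simpa [h.mean] using h.hasCondExp_smul hle measurable_id h.integrable hv hvi

/-- Degree two is what the proof needs, since at most two affine coefficients get multiplied; mean
and variance of `w` then determine the expectation. -/
theorem hasCondExp_mulVec [IsProbabilityMeasure μ] (h : IsFresh m μ w δ) (hle : m' ≤ m)
    {a b : Type*} [Fintype a] [Fintype b] {F : ℝ → Matrix a b ℝ} (hF : IsQuadratic F)
    {v g : Ω → b → ℝ} (hv : AEStronglyMeasurable[m] v μ) (hg : HasCondExp m' μ v g) :
    HasCondExp m' μ (fun ω => F (w ω) *ᵥ v ω)
      (fun ω => matExp μ (fun ω => F (w ω)) *ᵥ g ω) := by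
  obtain ⟨C₀, C₁, C₂, hF⟩ := hF
  have h0 := hg.mulVec C₀
  have h1 := (h.hasCondExp_smul_self hle hv hg.1).mulVec C₁
  have h2 := (h.hasCondExp_smul hle (measurable_id.pow_const 2) h.integrable_sq hv hg.1).mulVec C₂
  refine ((h0.add h1).add h2).congr (.of_forall fun ω => ?_) ?_
  · simp [hF, Matrix.add_mulVec, Matrix.smul_mulVec, Matrix.mulVec_smul]
  · filter_upwards [hg.2] with ω hω
    simp [hF, hω, h.matExp_quadratic, h.variance, Matrix.add_mulVec, Matrix.smul_mulVec,
      Matrix.mulVec_smul]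

end IsFresh

/-! ### Independence of an increment from the past information -/

section Info

variable {Ω : Type*} {mΩ : MeasurableSpace Ω} {μ : Measure Ω}

/-- The joint law is `X ⊗ (U ⊗ V)`, and associativity of product measures regroups it as `(X ⊗ U) ⊗
V`. -/
theorem IndepFun.prodMk_left_of_indepFun [IsProbabilityMeasure μ] {α β γ : Type*} [MeasurableSpace α] [MeasurableSpace β]
    [MeasurableSpace γ] {X : Ω → α} {U : Ω → β} {V : Ω → γ} (hX : Measurable X)
    (hU : Measurable U) (hV : Measurable V) (h : IndepFun X (fun ω => (U ω, V ω)) μ)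
    (hUV : IndepFun U V μ) : IndepFun (fun ω => (X ω, U ω)) V μ := by
  have hXU : IndepFun X U μ := h.comp measurable_id measurable_fst
  have := Measure.isProbabilityMeasure_map (μ := μ) hX.aemeasurable
  have := Measure.isProbabilityMeasure_map (μ := μ) hU.aemeasurable
  have := Measure.isProbabilityMeasure_map (μ := μ) hV.aemeasurable
  rw [indepFun_iff_map_prod_eq_prod_map_map (hX.prodMk hU).aemeasurable hV.aemeasurable,
    (indepFun_iff_map_prod_eq_prod_map_map hX.aemeasurable hU.aemeasurable).1 hXU]
  apply MeasurableEquiv.prodAssoc.map_measurableEquiv_injective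
  rw [Measure.prodAssoc_prod, Measure.map_map MeasurableEquiv.prodAssoc.measurable (by fun_prop),
    ← (indepFun_iff_map_prod_eq_prod_map_map hU.aemeasurable hV.aemeasurable).1 hUV,
    ← (indepFun_iff_map_prod_eq_prod_map_map hX.aemeasurable (hU.prodMk hV).aemeasurable).1 h]
  rfl

variable {n : ℕ} {δ : ℝ} {N : ℕ} {ξ : Ω → Fin n → ℝ} {dw : ℕ → Ω → ℝ}

theorem info_mono {i j : ℤ} (h : i ≤ j) : info ξ dw i ≤ info ξ dw j := by
  refine sup_le_sup_left (iSup₂_le fun l hl => ?_) _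
  exact le_iSup₂_of_le l (hl.trans h) le_rfl

theorem IsNoise.info_le (h : IsNoise μ δ N ξ dw) {j : ℤ} (hj : j ≤ N) : info ξ dw j ≤ mΩ :=
  sup_le h.measurable_init.comap_le
    (iSup₂_le fun l hl => (h.measurable l (by omega)).comap_le)

theorem measurable_info {k : ℕ} {j : ℤ} (h : (k : ℤ) ≤ j) : Measurable[info ξ dw j] (dw k) :=
  Measurable.of_comap_le (le_sup_of_le_right (le_iSup₂_of_le k h le_rfl))

theorem IsNoise.isFresh [IsProbabilityMeasure μ] (h : IsNoise μ δ N ξ dw) {k : ℕ} (hk : k ≤ N) :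
    IsFresh (info ξ dw ((k : ℤ) - 1)) μ (dw k) δ := by
  refine ⟨h.info_le (by omega), h.measurable k hk, h.memLp k hk, h.mean k hk, h.variance k hk, ?_⟩
  let f : Fin (N + 1) → Ω → ℝ := fun i => dw i
  have hf : ∀ i, Measurable (f i) := fun i => h.measurable i (by omega)
  let k' : Fin (N + 1) := ⟨k, by omega⟩
  let s : Finset (Fin (N + 1)) := Finset.univ.filter fun i => (i : ℕ) < k
  let U : Ω → s → ℝ := fun ω i => f i ω
  have hU : Measurable U := measurable_pi_lambda _ fun i => hf i
  have hUV : IndepFun U (dw k) μ :=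
    (h.indep.indepFun_finset s {k'} (by simp [s, k']) hf).comp measurable_id
      (measurable_pi_apply (⟨k', by simp⟩ : ({k'} : Finset (Fin (N + 1)))))
  have hX : IndepFun ξ (fun ω => (U ω, dw k ω)) μ :=
    h.indep_init.comp (φ := id) (ψ := fun y : Fin (N + 1) → ℝ => ((fun i : s => y i), y k'))
      measurable_id (by fun_prop)
  have key := IndepFun.prodMk_left_of_indepFun h.measurable_init hU (h.measurable k hk) hX hUV
  rw [IndepFun_iff_Indep] at key
  -- The pair `(ξ, U)` generates a σ-algebra containing the information at `k - 1`, as `U` collects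
  -- the increments before `k`.
  refine indep_of_indep_of_le_right key.symm (sup_le ?_ (iSup₂_le fun i hi => ?_))
  · exact (measurable_fst.comp (comap_measurable fun ω => (ξ ω, U ω))).comap_le
  · have hi' : (⟨i, by omega⟩ : Fin (N + 1)) ∈ s := by
      simp only [s, Finset.mem_filter, Finset.mem_univ, true_and]; omega
    exact ((measurable_pi_apply (⟨⟨i, by omega⟩, hi'⟩ : s)).comp
      (measurable_snd.comp (comap_measurable fun ω => (ξ ω, U ω)))).comap_le

end Info

/-! ### Linear algebra: solving the triangular system of estimates -/

namespace DelayGame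

variable {n m₁ m₂ : ℕ} (D : DelayGame n m₁ m₂) (S : RiccatiFamily n)

/-- `P̂_{2,k}^{k+m-1}` acting on both blocks. -/
def blockP (k m : ℕ) : Matrix (Fin n ⊕ Fin n) (Fin n ⊕ Fin n) ℝ :=
  Matrix.fromBlocks (S.Ph 1 k (k + m - 1)) 0 0 (S.Ph 1 k (k + m - 1))

theorem sum_Icc_pred {M : Type*} [AddCommMonoid M] (f : ℕ → M) {l q : ℕ} (hl : 1 ≤ l) :
    ∑ j ∈ Finset.Icc l q, f (j - 1) = ∑ j ∈ Finset.Ico (l - 1) q, f j := by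
  refine Finset.sum_bij' (fun j _ => j - 1) (fun j _ => j + 1) ?_ ?_ ?_ ?_ fun _ _ => rfl <;>
    simp only [Finset.mem_Icc, Finset.mem_Ico] <;> omega

theorem sum_blockP (k l q : ℕ) (hl : 1 ≤ l) :
    ∑ j ∈ Finset.Icc l q, blockP S k j =
      Matrix.fromBlocks (∑ j ∈ Finset.Ico (l - 1) q, S.Ph 1 k (k + j)) 0 0
        (∑ j ∈ Finset.Ico (l - 1) q, S.Ph 1 k (k + j)) := by
  have e : ∀ j ∈ Finset.Icc l q, blockP S k j = Matrix.fromBlocks (S.Ph 1 k (k + (j - 1))) 0 0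
      (S.Ph 1 k (k + (j - 1))) := fun j hj => by
    rw [Finset.mem_Icc] at hj
    rw [blockP, Nat.add_sub_assoc (by omega)]
  rw [Finset.sum_congr rfl e, ← sum_Icc_pred _ hl]
  ext (i | i) (j | j) <;> simp [Matrix.sum_apply]

theorem blockB_mul_sum_blockP (k l q : ℕ) (hl : 1 ≤ l) :
    D.blockB * ∑ j ∈ Finset.Icc l q, blockP S k j =
      Matrix.fromBlocks (D.Bh12 * ∑ j ∈ Finset.Ico (l - 1) q, S.Ph 1 k (k + j)) 0
        (D.δ • (D.Bb12 * ∑ j ∈ Finset.Ico (l - 1) q, S.Ph 1 k (k + j))) 0 := by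
  rw [sum_blockP S k l q hl, blockB, Matrix.fromBlocks_multiply]
  simp

theorem partialS_eq_add_Sc (i : Fin 2) (k : ℕ) {l : ℕ} (hl : l ≤ D.d₁ - D.d₂ - 1) :
    D.partialS S i k l =
      D.Sc S i k + ∑ j ∈ Finset.Ico l (D.d₁ - D.d₂ - 1), S.Ph i k (k + j) := by
  rw [Sc, partialS, partialS,
    ← Finset.sum_Ico_consecutive (fun j => S.Ph i k (k + j)) hl (by omega : _ ≤ D.d₁)]
  abel

/-- In the equation for `Y m`, every term `blockP j` with `j ≥ m` acts on `Y m` itself. Moving these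
terms to the left turns `Gammac` into `Gamma`. -/
theorem Gamma_eq (k : ℕ) {m : ℕ} (hm : 1 ≤ m) (hm' : m ≤ D.d₁ - D.d₂ - 1) :
    D.Gamma S k m = D.Gammac S k
      - D.blockB * ∑ j ∈ Finset.Icc m (D.d₁ - D.d₂ - 1), blockP S k j := by
  rw [blockB_mul_sum_blockP D S k m _ hm, Gamma, Gammac, Sm,
    partialS_eq_add_Sc D S 1 k (by omega : m - 1 ≤ _), sub_eq_add_neg (Matrix.fromBlocks _ _ _ _),
    Matrix.fromBlocks_neg, Matrix.fromBlocks_add, Matrix.mul_add, Matrix.mul_add, smul_add]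
  congr 1 <;> abel

/-- At index `0` all estimates coincide with `Y 0`, so the terms of player 1, gathered in `G`, move
to the left as well. -/
theorem Gammah_eq (k : ℕ) :
    D.Gammah S k = D.Gammac S k - D.G S k
      - D.blockB * ∑ j ∈ Finset.Icc 1 (D.d₁ - D.d₂ - 1), blockP S k j := by
  rw [blockB_mul_sum_blockP D S k 1 _ le_rfl, Gammah, Gammac, G, Sh, Sh,
    partialS_eq_add_Sc D S 1 k (Nat.zero_le _), sub_eq_add_neg _ (Matrix.fromBlocks _ _ _ _),
    sub_eq_add_neg _ (Matrix.fromBlocks _ _ _ _),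
    Matrix.fromBlocks_neg, Matrix.fromBlocks_neg, Matrix.fromBlocks_add, Matrix.fromBlocks_add,
    Matrix.mul_add D.Bh12, Matrix.mul_add D.Bb12, smul_add, smul_add, smul_add]
  congr 1 <;> simp <;> abel

/-- Resolution of the linear system satisfied by the estimates `Y r`, `r ≤ d₁ - d₂`, of the state
and of its product with the noise. -/
theorem sum_blockP_mulVec_eq (k : ℕ) (Y c : ℕ → Fin n ⊕ Fin n → ℝ) (g : Fin n ⊕ Fin n → ℝ)
    (hΓ : ∀ m, 1 ≤ m → m < D.d₁ - D.d₂ → IsUnit (D.Gamma S k m))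
    (hY : ∀ r, 1 ≤ r → r < D.d₁ - D.d₂ → Y r = c r + g + (1 - D.Gammac S k) *ᵥ Y r
      + D.blockB *ᵥ ∑ j ∈ Finset.Icc 1 (D.d₁ - D.d₂ - 1), blockP S k j *ᵥ Y (min r j))
    {s : ℕ} (hs : s < D.d₁ - D.d₂) :
    ∑ j ∈ Finset.Icc 1 s, blockP S k j *ᵥ Y j =
      ∑ j ∈ Finset.Icc 1 s, (D.Zprod S k j (s - j) * D.K S k j) *ᵥ (c j + g) := by
  induction s with
  | zero => simp
  | succ s ih =>
    have hsplit : ∑ j ∈ Finset.Icc 1 (D.d₁ - D.d₂ - 1), blockP S k j *ᵥ Y (min (s + 1) j) =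
        ∑ j ∈ Finset.Icc 1 s, blockP S k j *ᵥ Y j
          + (∑ j ∈ Finset.Icc (s + 1) (D.d₁ - D.d₂ - 1), blockP S k j) *ᵥ Y (s + 1) := by
      have hu : Finset.Icc 1 (D.d₁ - D.d₂ - 1) =
          Finset.Icc 1 s ∪ Finset.Icc (s + 1) (D.d₁ - D.d₂ - 1) := by
        ext j; simp only [Finset.mem_union, Finset.mem_Icc]; omega
      rw [hu, Finset.sum_union, Matrix.sum_mulVec]
      · congr 1 <;> refine Finset.sum_congr rfl fun j hj => ?_ <;> rw [Finset.mem_Icc] at hj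
        · rw [min_eq_right (by omega)]
        · rw [min_eq_left (by omega)]
      · rw [Finset.disjoint_left]; intro j; simp only [Finset.mem_Icc]; omega
    -- The terms `j ≥ s + 1` are absorbed on the left; those with `j ≤ s` are known from earlier
    -- substitutions.
    have h1 : D.Gamma S k (s + 1) *ᵥ Y (s + 1) =
        c (s + 1) + g + D.blockB *ᵥ ∑ j ∈ Finset.Icc 1 s, blockP S k j *ᵥ Y j := by
      have := hY (s + 1) (by omega) hs
      rw [hsplit, Matrix.mulVec_add, Matrix.sub_mulVec, Matrix.one_mulVec] at this
      rw [Gamma_eq D S k (by omega) (by omega), Matrix.sub_mulVec, ← Matrix.mulVec_mulVec,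
        sub_eq_iff_eq_add, ← sub_eq_zero]
      rw [← sub_eq_zero] at this
      rw [← this]
      abel
    have h2 : blockP S k (s + 1) *ᵥ Y (s + 1) = D.K S k (s + 1) *ᵥ (c (s + 1) + g)
        + (D.K S k (s + 1) * D.blockB) *ᵥ ∑ j ∈ Finset.Icc 1 s, blockP S k j *ᵥ Y j := by
      rw [← Matrix.mulVec_mulVec, ← Matrix.mulVec_add, ← h1, Matrix.mulVec_mulVec, K, blockP,
        Matrix.mul_assoc, Matrix.nonsing_inv_mul _
          ((Matrix.isUnit_iff_isUnit_det _).1 (hΓ (s + 1) (by omega) hs)), Matrix.mul_one]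
    -- With `T s` the partial sum, `h2` reads `T (s+1) = (1 + K (s+1) B) T s + K (s+1) (c (s+1) +
    -- g)`; unrolling it produces `Zprod`.
    rw [Finset.sum_Icc_succ_top (by omega), Finset.sum_Icc_succ_top (by omega), h2,
      add_left_comm, add_comm (D.K S k (s + 1) *ᵥ _)]
    congr 1
    swap
    · simp [Zprod]
    · rw [ih (by omega), ← Matrix.one_mulVec (∑ j ∈ Finset.Icc 1 s, _), Matrix.mulVec_mulVec,
        Matrix.mul_one, ← Matrix.add_mulVec, Matrix.mulVec_sum]
      refine Finset.sum_congr rfl fun j hj => ?_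
      rw [Finset.mem_Icc] at hj
      rw [Nat.sub_add_comm hj.2, Zprod, Matrix.mulVec_mulVec, Matrix.mul_assoc,
        show j + (s - j) + 1 = s + 1 by omega]

/-- Three solves: `Gammah` gives `Y 0`, forward substitution gives the weighted sum `T` of the
intermediate `Y j`, and `Gammac` gives the last `Y`. The noise value `z` enters only through the
outer rows, so it can be fixed here. -/
theorem closedLoop_of_system (k : ℕ) (z : ℝ) (Y : ℕ → Fin n ⊕ Fin n → ℝ) (U : ℕ → Fin n → ℝ)
    (hd : D.d₂ < D.d₁) (hΓh : IsUnit (D.Gammah S (k + 1)))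
    (hΓ : ∀ m, 1 ≤ m → m < D.d₁ - D.d₂ → IsUnit (D.Gamma S (k + 1) m))
    (hΓc : IsUnit (D.Gammac S (k + 1)))
    (hY : ∀ r ≤ D.d₁ - D.d₂, Y r = D.colA *ᵥ U r + D.G S (k + 1) *ᵥ Y 0
      + (1 - D.Gammac S (k + 1)) *ᵥ Y r
      + D.blockB *ᵥ ∑ j ∈ Finset.Icc 1 (D.d₁ - D.d₂ - 1), blockP S (k + 1) j *ᵥ Y (min r j)) :
    D.row1 S k z *ᵥ Y 0 + D.row2 S k z *ᵥ Y (D.d₁ - D.d₂)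
        + Matrix.fromCols (D.rB12 z) 0 *ᵥ
          ∑ j ∈ Finset.Icc 1 (D.d₁ - D.d₂ - 1), blockP S (k + 1) j *ᵥ Y j =
      D.M S k z *ᵥ U 0 + ∑ m ∈ Finset.Icc 1 (D.d₁ - D.d₂ - 1), D.Mm S k m z *ᵥ U m
        + D.Hm S k z *ᵥ U (D.d₁ - D.d₂) := by
  set T := ∑ j ∈ Finset.Icc 1 (D.d₁ - D.d₂ - 1), blockP S (k + 1) j *ᵥ Y j with hT
  set ZK := ∑ j ∈ Finset.Icc 1 (D.d₁ - D.d₂ - 1), D.Z S (k + 1) j * D.K S (k + 1) j with hZK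
  have h0 : Y 0 = ((D.Gammah S (k + 1))⁻¹ * D.colA) *ᵥ U 0 := by
    have := hY 0 (Nat.zero_le _)
    simp only [Nat.zero_min, ← Matrix.sum_mulVec] at this
    have h : D.Gammah S (k + 1) *ᵥ Y 0 = D.colA *ᵥ U 0 := by
      rw [Gammah_eq, Matrix.sub_mulVec, Matrix.sub_mulVec, ← Matrix.mulVec_mulVec]
      rw [Matrix.sub_mulVec, Matrix.one_mulVec, ← sub_eq_zero] at this
      rw [← sub_eq_zero, ← this]
      abel
    rw [← Matrix.mulVec_mulVec, ← h, Matrix.mulVec_mulVec, Matrix.nonsing_inv_mul _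
      ((Matrix.isUnit_iff_isUnit_det _).1 hΓh), Matrix.one_mulVec]
  have hTeq : T = ZK *ᵥ (D.G S (k + 1) *ᵥ Y 0) + ∑ j ∈ Finset.Icc 1 (D.d₁ - D.d₂ - 1),
      (D.Z S (k + 1) j * D.K S (k + 1) j * D.colA) *ᵥ U j := by
    rw [hT, sum_blockP_mulVec_eq D S (k + 1) Y (fun r => D.colA *ᵥ U r) (D.G S (k + 1) *ᵥ Y 0) hΓ
      (fun r _ hr => hY r hr.le) (by omega), hZK, Matrix.sum_mulVec, ← Finset.sum_add_distrib]
    refine Finset.sum_congr rfl fun j _ => ?_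
    rw [Matrix.mulVec_add, Z, Matrix.mulVec_mulVec, add_comm]
  have hd' : Y (D.d₁ - D.d₂) = (D.Gammac S (k + 1))⁻¹ *ᵥ
      (D.colA *ᵥ U (D.d₁ - D.d₂) + D.G S (k + 1) *ᵥ Y 0 + D.blockB *ᵥ T) := by
    have := hY _ le_rfl
    have e : ∑ j ∈ Finset.Icc 1 (D.d₁ - D.d₂ - 1), blockP S (k + 1) j *ᵥ Y (min (D.d₁ - D.d₂) j)
        = T := by
      refine Finset.sum_congr rfl fun j hj => ?_
      rw [Finset.mem_Icc] at hj
      rw [min_eq_right (by omega)]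
    rw [e] at this
    have h : D.Gammac S (k + 1) *ᵥ Y (D.d₁ - D.d₂) =
        D.colA *ᵥ U (D.d₁ - D.d₂) + D.G S (k + 1) *ᵥ Y 0 + D.blockB *ᵥ T := by
      rw [Matrix.sub_mulVec, Matrix.one_mulVec, ← sub_eq_zero] at this
      rw [← sub_eq_zero, ← this]
      abel
    rw [← h, Matrix.mulVec_mulVec, Matrix.nonsing_inv_mul _
      ((Matrix.isUnit_iff_isUnit_det _).1 hΓc), Matrix.one_mulVec]
  have hM : D.M S k z *ᵥ U 0 = (D.row1 S k z
      + D.row2 S k z * (D.Gammac S (k + 1))⁻¹ * D.G S (k + 1)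
      + D.bracket S k z * ZK * D.G S (k + 1)) *ᵥ Y 0 := by
    rw [h0, M, Matrix.mul_assoc _ (D.Gammah S (k + 1))⁻¹, ← Matrix.mulVec_mulVec]
  have hMm : ∑ m ∈ Finset.Icc 1 (D.d₁ - D.d₂ - 1), D.Mm S k m z *ᵥ U m =
      D.bracket S k z *ᵥ ∑ j ∈ Finset.Icc 1 (D.d₁ - D.d₂ - 1),
        (D.Z S (k + 1) j * D.K S (k + 1) j * D.colA) *ᵥ U j := by
    rw [Matrix.mulVec_sum]
    refine Finset.sum_congr rfl fun j hj => ?_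
    rw [Finset.mem_Icc] at hj
    rw [Mm, if_pos (by omega), Matrix.mulVec_mulVec]
    simp only [Matrix.mul_assoc]
  rw [hM, hMm, hd']
  have hT' : ∑ j ∈ Finset.Icc 1 (D.d₁ - D.d₂ - 1),
      (D.Z S (k + 1) j * D.K S (k + 1) j * D.colA) *ᵥ U j = T - ZK *ᵥ (D.G S (k + 1) *ᵥ Y 0) := by
    rw [hTeq]; abel
  rw [hT', Hm, bracket]
  simp only [Matrix.mulVec_add, Matrix.add_mulVec, Matrix.mulVec_sub, Matrix.add_mul,
    ← Matrix.mulVec_mulVec]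
  abel

end DelayGame

/-! ### Adaptedness of the state and estimates of the adjoint processes -/

theorem MeasureTheory.AEStronglyMeasurable.mulVec_of_measurable {Ω a b : Type*} [Fintype a] [Fintype b]
    {m mΩ : MeasurableSpace Ω} {μ : Measure Ω} {w : Ω → ℝ} (hw : Measurable[m] w)
    {F : ℝ → Matrix a b ℝ} (hF : IsAffine F) {v : Ω → b → ℝ} (hv : AEStronglyMeasurable[m] v μ) :
    AEStronglyMeasurable[m] (fun ω => F (w ω) *ᵥ v ω) μ := by
  obtain ⟨C₀, C₁, hF⟩ := hF
  have h (C : Matrix a b ℝ) : AEStronglyMeasurable[m] (fun ω => C *ᵥ v ω) μ :=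
    (Matrix.mulVecLin C).toContinuousLinearMap.continuous.comp_aestronglyMeasurable hv
  simp only [hF, Matrix.add_mulVec, Matrix.smul_mulVec]
  exact (h C₀).add (hw.stronglyMeasurable.aestronglyMeasurable.smul (h C₁))

section

variable {Ω : Type*} {mΩ : MeasurableSpace Ω} {μ : Measure Ω}
  {n : ℕ} {δ : ℝ} {N : ℕ} {ξ : Ω → Fin n → ℝ} {dw : ℕ → Ω → ℝ}

theorem IsNoise.hasCondExp_condExp [IsProbabilityMeasure μ] (h : IsNoise μ δ N ξ dw) {E : Type*} [NormedAddCommGroup E]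
    [NormedSpace ℝ E] [CompleteSpace E] {i j : ℤ} (hi : i ≤ N) (hj : j ≤ N) (f : Ω → E) :
    HasCondExp (info ξ dw i) μ (μ[f | info ξ dw j]) (μ[f | info ξ dw (min i j)]) := by
  rcases le_total i j with hij | hij
  · rw [min_eq_left hij]
    exact .condExp_of_le (info_mono hij) (h.info_le hj) f
  · rw [min_eq_right hij]
    exact .condExp_of_ge (info_mono hij) (h.info_le hi) f

theorem aestronglyMeasurable_condExp_info {E : Type*} [NormedAddCommGroup E]
    [NormedSpace ℝ E] [CompleteSpace E] {i j : ℤ} (hij : i ≤ j) (f : Ω → E) :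
    AEStronglyMeasurable[info ξ dw j] (μ[f | info ξ dw i]) μ :=
  (stronglyMeasurable_condExp.mono (info_mono hij)).aestronglyMeasurable

end

namespace DelayGame

variable {n m₁ m₂ : ℕ} (D : DelayGame n m₁ m₂) (S : RiccatiFamily n)

theorem isAffine_rA : IsAffine D.rA := ⟨_, _, fun _ => rfl⟩
theorem isAffine_rB11 : IsAffine D.rB11 := ⟨_, _, fun _ => rfl⟩
theorem isAffine_rB12 : IsAffine D.rB12 := ⟨_, _, fun _ => rfl⟩
theorem isAffine_rB21 : IsAffine D.rB21 := ⟨_, _, fun _ => rfl⟩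
theorem isAffine_rB22 : IsAffine D.rB22 := ⟨_, _, fun _ => rfl⟩

/-- The time index `κ - d₁ - 1 + r`: information available to player 1 at `κ`, `r` steps later. -/
def lag (κ r : ℕ) : ℤ := κ - D.d₁ - 1 + r

theorem min_lag (κ r s : ℕ) : min (D.lag κ r) (D.lag κ s) = D.lag κ (min r s) := by
  unfold lag; omega

theorem lag_delay₁ (κ : ℕ) : (κ : ℤ) - D.d₁ - 1 = D.lag κ 0 := by simp [lag]

theorem lag_delay₂ (κ : ℕ) (hd : D.d₂ < D.d₁) :
    (κ : ℤ) - D.d₂ - 1 = D.lag κ (D.d₁ - D.d₂) := by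
  unfold lag; omega

theorem lag_le (κ : ℕ) {r : ℕ} (hr : r ≤ D.d₁) : D.lag κ r ≤ (κ : ℤ) - 1 := by
  unfold lag; omega

variable {Ω : Type*} [mΩ : MeasurableSpace Ω] {μ : Measure Ω}
  {ξ : Ω → Fin n → ℝ} {dw : ℕ → Ω → ℝ} {x : ℕ → Ω → Fin n → ℝ} {p : Fin 2 → ℕ → Ω → Fin n → ℝ}

variable {D}

/-- The forward equation builds `x (k + 1)` from `x k`, `dw k` and estimates on earlier information.
Hence `dw k` is still fresh relative to `x k`. -/
theorem IsSolution.adapted (hsol : D.IsSolution μ ξ dw x p) :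
    ∀ k ≤ D.N + 1, AEStronglyMeasurable[info ξ dw ((k : ℤ) - 1)] (x k) μ := by
  intro k hk
  induction k with
  | zero =>
    refine AEStronglyMeasurable.congr ?_ hsol.init.symm
    have : Measurable[info ξ dw (((0 : ℕ) : ℤ) - 1)] ξ := Measurable.of_comap_le le_sup_left
    exact this.stronglyMeasurable.aestronglyMeasurable
  | succ k ih =>
    refine AEStronglyMeasurable.congr ?_ (Filter.EventuallyEq.symm (hsol.forward k (by omega)))
    have hw : Measurable[info ξ dw (((k + 1 : ℕ) : ℤ) - 1)] (dw k) := measurable_info (by omega)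
    have hx := (ih (by omega)).mono (info_mono (ξ := ξ) (dw := dw)
      (by omega : (k : ℤ) - 1 ≤ ((k + 1 : ℕ) : ℤ) - 1))
    have hc (d : ℕ) (f : Ω → Fin n → ℝ) := aestronglyMeasurable_condExp_info (μ := μ) (ξ := ξ)
      (dw := dw) (by omega : (k : ℤ) - d - 1 ≤ ((k + 1 : ℕ) : ℤ) - 1) f
    exact ((((hx.mulVec_of_measurable hw D.isAffine_rA).add
      ((hc _ _).mulVec_of_measurable hw D.isAffine_rB11)).add
      ((hc _ _).mulVec_of_measurable hw D.isAffine_rB12)).add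
      (((hc _ _).mulVec_of_measurable hw D.isAffine_rB21).const_smul (1 / D.δ))).add
      (((hc _ _).mulVec_of_measurable hw D.isAffine_rB22).const_smul (1 / D.δ))

theorem IsSolution.integrable_x [IsProbabilityMeasure μ] (hsol : D.IsSolution μ ξ dw x p) {k : ℕ} (hk : k ≤ D.N + 1) :
    Integrable (x k) μ :=
  (hsol.memLp_x k hk).integrable (by norm_num)

theorem integrable_smul_x (hdw : IsNoise μ D.δ D.N ξ dw) (hsol : D.IsSolution μ ξ dw x p)
    {k j : ℕ} (hk : k ≤ D.N + 1) (hj : j ≤ D.N) : Integrable (fun ω => dw j ω • x k ω) μ :=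
  memLp_one_iff_integrable.1 ((hsol.memLp_x k hk).smul (hdw.memLp j hj))

variable (D) in
/-- The feedback representation of the adjoint process `p i κ` in terms of the estimates of
`x (κ + 1)`. -/
def HasFeedback (μ : Measure Ω) (ξ : Ω → Fin n → ℝ) (dw : ℕ → Ω → ℝ) (x : ℕ → Ω → Fin n → ℝ)
    (p : Fin 2 → ℕ → Ω → Fin n → ℝ) (κ : ℕ) : Prop :=
  ∀ i, ∀ᵐ ω ∂μ, p i κ ω = S.P i (κ + 1) *ᵥ x (κ + 1) ω
    + ∑ j ∈ Finset.range D.d₁, S.Ph i (κ + 1) (κ + 1 + j) *ᵥ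
        (μ[x (κ + 1) | info ξ dw (D.lag κ (j + 1))]) ω
    + ∑ j ∈ Finset.range D.d₂, S.Pc i (κ + 1) (κ + 1 + j) *ᵥ
        (μ[x (κ + 1) | info ξ dw (D.lag κ (D.d₁ - D.d₂ + j + 1))]) ω

variable {S}

theorem hasFeedback_terminal (hS : D.IsRiccati S μ dw) (hsol : D.IsSolution μ ξ dw x p) :
    D.HasFeedback S μ ξ dw x p D.N := by
  intro i
  filter_upwards [hsol.terminal i] with ω hω
  have h1 (j : ℕ) : S.Ph i (D.N + 1) (D.N + 1 + j) = 0 := hS.terminal_Ph i _ (by omega)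
  have h2 (j : ℕ) : S.Pc i (D.N + 1) (D.N + 1 + j) = 0 := hS.terminal_Pc i _ (by omega)
  simp [hω, hS.terminal, h1, h2]

/-- By nesting, each estimate drops to the smaller of the two indices. The `Pc` terms have indices
above `d₁ - d₂ ≥ r`, so all of them drop to `r`. -/
theorem HasFeedback.hasCondExp [IsProbabilityMeasure μ] {κ : ℕ} (h : D.HasFeedback S μ ξ dw x p κ)
    (hdw : IsNoise μ D.δ D.N ξ dw) (hsol : D.IsSolution μ ξ dw x p) (hd : D.d₂ < D.d₁)
    (hκ : κ ≤ D.N) (i : Fin 2) {r : ℕ} (hr : r ≤ D.d₁ - D.d₂) :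
    HasCondExp (info ξ dw (D.lag κ r)) μ (p i κ) (fun ω =>
      S.P i (κ + 1) *ᵥ (μ[x (κ + 1) | info ξ dw (D.lag κ r)]) ω
      + ∑ j ∈ Finset.range D.d₁, S.Ph i (κ + 1) (κ + 1 + j) *ᵥ
          (μ[x (κ + 1) | info ξ dw (D.lag κ (min r (j + 1)))]) ω
      + ∑ j ∈ Finset.range D.d₂, S.Pc i (κ + 1) (κ + 1 + j) *ᵥ
          (μ[x (κ + 1) | info ξ dw (D.lag κ r)]) ω) := by
  have hle {s : ℕ} (hs : s ≤ D.d₁) : D.lag κ s ≤ D.N := by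
    have := D.lag_le κ hs; omega
  refine HasCondExp.congr ?_ (h i) .rfl
  refine (((HasCondExp.refl (hsol.integrable_x (by omega))).mulVec _).add
    (.sum _ fun j hj => .mulVec _ ?_)).add (.sum _ fun j hj => .mulVec _ ?_)
  · rw [Finset.mem_range] at hj
    rw [← min_lag]
    exact hdw.hasCondExp_condExp (hle (by omega)) (hle (by omega)) _
  · rw [Finset.mem_range] at hj
    have := hdw.hasCondExp_condExp (hle (by omega : r ≤ D.d₁))
      (hle (by omega : D.d₁ - D.d₂ + j + 1 ≤ D.d₁)) (x (κ + 1))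
    rwa [min_lag, min_eq_left (by omega)] at this

/-- Every estimate in the feedback formula is known at `κ - 1`, so multiplying by the centred `dw κ`
annihilates it under conditioning. Only the term in `x (κ + 1)`, which itself depends on `dw κ`,
survives. -/
theorem HasFeedback.hasCondExp_smul [IsProbabilityMeasure μ] {κ : ℕ} (h : D.HasFeedback S μ ξ dw x p κ)
    (hdw : IsNoise μ D.δ D.N ξ dw) (hsol : D.IsSolution μ ξ dw x p) (hd : D.d₂ < D.d₁)
    (hκ : κ ≤ D.N) (i : Fin 2) {r : ℕ} (hr : r ≤ D.d₁) :
    HasCondExp (info ξ dw (D.lag κ r)) μ (fun ω => dw κ ω • p i κ ω) (fun ω =>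
      S.P i (κ + 1) *ᵥ (μ[fun ω => dw κ ω • x (κ + 1) ω | info ξ dw (D.lag κ r)]) ω) := by
  have hz {s : ℕ} (hs : s ≤ D.d₁) := (hdw.isFresh hκ).hasCondExp_smul_self
    (info_mono (D.lag_le κ hr)) (aestronglyMeasurable_condExp_info (D.lag_le κ hs) (x (κ + 1)))
    integrable_condExp
  have key := (((HasCondExp.refl (m := info ξ dw (D.lag κ r))
    (integrable_smul_x (k := κ + 1) hdw hsol (by omega) hκ)).mulVec
      (S.P i (κ + 1))).add
    (.sum (Finset.range D.d₁) fun j hj => .mulVec (S.Ph i (κ + 1) (κ + 1 + j))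
      (hz (by rw [Finset.mem_range] at hj; omega : j + 1 ≤ D.d₁)))).add
    (.sum (Finset.range D.d₂) fun j hj => .mulVec (S.Pc i (κ + 1) (κ + 1 + j))
      (hz (by rw [Finset.mem_range] at hj; omega : D.d₁ - D.d₂ + j + 1 ≤ D.d₁)))
  refine key.congr ?_ (.of_forall fun ω => by simp)
  filter_upwards [h i] with ω hω
  simp only [hω, smul_add, Finset.smul_sum, Matrix.mulVec_smul]

end DelayGame

/-! ### The block system and the closed loop -/

theorem sumElim_finsetSum {ι a b : Type*} (s : Finset ι) (f : ι → a → ℝ) (g : ι → b → ℝ) :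
    ∑ j ∈ s, Sum.elim (f j) (g j) = Sum.elim (∑ j ∈ s, f j) (∑ j ∈ s, g j) := by
  ext (i | i) <;> simp

theorem MeasureTheory.AEStronglyMeasurable.const_mulVec {Ω a b : Type*} [Fintype a] [Fintype b]
    {m mΩ : MeasurableSpace Ω} {μ : Measure Ω} (C : Matrix a b ℝ) {v : Ω → b → ℝ}
    (hv : AEStronglyMeasurable[m] v μ) : AEStronglyMeasurable[m] (fun ω => C *ᵥ v ω) μ :=
  (Matrix.mulVecLin C).toContinuousLinearMap.continuous.comp_aestronglyMeasurable hv

theorem MeasureTheory.AEStronglyMeasurable.finsetSum {Ω E ι : Type*} [NormedAddCommGroup E]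
    {m mΩ : MeasurableSpace Ω} {μ : Measure Ω} (s : Finset ι) {f : ι → Ω → E}
    (h : ∀ i ∈ s, AEStronglyMeasurable[m] (f i) μ) :
    AEStronglyMeasurable[m] (fun ω => ∑ i ∈ s, f i ω) μ := by
  classical
  induction s using Finset.induction_on with
  | empty => simpa using! aestronglyMeasurable_const
  | insert i s hi ih =>
    simp only [Finset.sum_insert hi]
    exact (h i (by simp)).add (ih fun j hj => h j (by simp [hj]))

namespace DelayGame

variable {n m₁ m₂ : ℕ} (D : DelayGame n m₁ m₂) (S : RiccatiFamily n)

theorem one_sub_Gammac (k : ℕ) : 1 - D.Gammac S k =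
    Matrix.fromBlocks (D.Bh12 * D.Sc S 1 k) ((1 / D.δ) • (D.Bh22 * S.P 1 k))
      (D.δ • (D.Bb12 * D.Sc S 1 k)) (D.Bb22 * S.P 1 k) := by
  rw [Gammac, ← Matrix.fromBlocks_one, sub_eq_add_neg, Matrix.fromBlocks_neg,
    Matrix.fromBlocks_add]
  congr 1 <;> abel

theorem blockP_mulVec (k m : ℕ) (u v : Fin n → ℝ) : blockP S k m *ᵥ Sum.elim u v =
    Sum.elim (S.Ph 1 k (k + m - 1) *ᵥ u) (S.Ph 1 k (k + m - 1) *ᵥ v) := by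
  simp [blockP, Matrix.fromBlocks_mulVec]

/-- The two hypotheses are the conditioned forward equation and its product with the noise. The
former carries the means of the random coefficients, the latter `δ` times their noise parts; this is
the origin of the two block rows. -/
theorem block_system (hδ : D.δ ≠ 0) (k : ℕ) (X W U : ℕ → Fin n → ℝ) (r : ℕ)
    (hX : X r = D.Ah *ᵥ U r + D.Bh11 *ᵥ (D.Sh S 0 k *ᵥ X 0)
      + D.Bh12 *ᵥ (D.Sc S 1 k *ᵥ X r
        + ∑ j ∈ Finset.Icc 1 (D.d₁ - D.d₂ - 1), S.Ph 1 k (k + j - 1) *ᵥ X (min r j))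
      + (1 / D.δ) • (D.Bh21 *ᵥ (S.P 0 k *ᵥ W 0)) + (1 / D.δ) • (D.Bh22 *ᵥ (S.P 1 k *ᵥ W r)))
    (hW : W r = (D.δ • D.Ab) *ᵥ U r + (D.δ • D.Bb11) *ᵥ (D.Sh S 0 k *ᵥ X 0)
      + (D.δ • D.Bb12) *ᵥ (D.Sc S 1 k *ᵥ X r
        + ∑ j ∈ Finset.Icc 1 (D.d₁ - D.d₂ - 1), S.Ph 1 k (k + j - 1) *ᵥ X (min r j))
      + (1 / D.δ) • ((D.δ • D.Bb21) *ᵥ (S.P 0 k *ᵥ W 0))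
      + (1 / D.δ) • ((D.δ • D.Bb22) *ᵥ (S.P 1 k *ᵥ W r))) :
    Sum.elim (X r) (W r) = D.colA *ᵥ U r + D.G S k *ᵥ Sum.elim (X 0) (W 0)
      + (1 - D.Gammac S k) *ᵥ Sum.elim (X r) (W r)
      + D.blockB *ᵥ ∑ j ∈ Finset.Icc 1 (D.d₁ - D.d₂ - 1),
          blockP S k j *ᵥ Sum.elim (X (min r j)) (W (min r j)) := by
  simp only [blockP_mulVec, sumElim_finsetSum, one_sub_Gammac, colA, G, blockB,
    Matrix.fromRows_mulVec, Matrix.fromBlocks_mulVec, Sum.elim_comp_inl, Sum.elim_comp_inr,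
    ← Sum.elim_add_add]
  congr 1
  · nth_rw 1 [hX]
    simp only [Matrix.mulVec_add, Matrix.smul_mulVec, Matrix.zero_mulVec, ← Matrix.mulVec_mulVec]
    abel
  · nth_rw 1 [hW]
    simp only [Matrix.mulVec_add, Matrix.smul_mulVec, Matrix.zero_mulVec, ← Matrix.mulVec_mulVec,
      smul_smul, one_div, inv_mul_cancel₀ hδ, one_smul]
    abel

variable {S} {Ω : Type*} [mΩ : MeasurableSpace Ω] {μ : Measure Ω} [IsProbabilityMeasure μ]
  {ξ : Ω → Fin n → ℝ} {dw : ℕ → Ω → ℝ} {x : ℕ → Ω → Fin n → ℝ} {p : Fin 2 → ℕ → Ω → Fin n → ℝ}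
  {D} {κ : ℕ}

theorem HasFeedback.condExp_zero (h : D.HasFeedback S μ ξ dw x p κ)
    (hdw : IsNoise μ D.δ D.N ξ dw) (hsol : D.IsSolution μ ξ dw x p) (hd : D.d₂ < D.d₁)
    (hκ : κ ≤ D.N) (i : Fin 2) : μ[p i κ | info ξ dw (D.lag κ 0)] =ᵐ[μ] fun ω =>
      D.Sh S i (κ + 1) *ᵥ (μ[x (κ + 1) | info ξ dw (D.lag κ 0)]) ω := by
  refine (h.hasCondExp hdw hsol hd hκ i (Nat.zero_le _)).2.trans (.of_forall fun ω => ?_)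
  simp only [Nat.zero_min, ← Matrix.sum_mulVec, ← Matrix.add_mulVec]
  rw [Sh, partialS, Finset.range_eq_Ico]

/-- The coefficient `Ph` number `j` sits at index `j + 1`, so those with `j ≥ d₁ - d₂ - 1` merge
with index `d₁ - d₂` and form `Sc`; the earlier ones keep their own estimates. -/
theorem HasFeedback.condExp_delay (h : D.HasFeedback S μ ξ dw x p κ)
    (hdw : IsNoise μ D.δ D.N ξ dw) (hsol : D.IsSolution μ ξ dw x p) (hd : D.d₂ < D.d₁)
    (hκ : κ ≤ D.N) (i : Fin 2) :
    μ[p i κ | info ξ dw (D.lag κ (D.d₁ - D.d₂))] =ᵐ[μ] fun ω =>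
      D.Sc S i (κ + 1) *ᵥ (μ[x (κ + 1) | info ξ dw (D.lag κ (D.d₁ - D.d₂))]) ω
      + ∑ j ∈ Finset.Icc 1 (D.d₁ - D.d₂ - 1), S.Ph i (κ + 1) (κ + 1 + j - 1) *ᵥ
          (μ[x (κ + 1) | info ξ dw (D.lag κ j)]) ω := by
  refine (h.hasCondExp hdw hsol hd hκ i le_rfl).2.trans (.of_forall fun ω => ?_)
  have e1 : ∑ j ∈ Finset.Icc 1 (D.d₁ - D.d₂ - 1), S.Ph i (κ + 1) (κ + 1 + j - 1) *ᵥ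
      (μ[x (κ + 1) | info ξ dw (D.lag κ j)]) ω =
      ∑ j ∈ Finset.Ico 0 (D.d₁ - D.d₂ - 1), S.Ph i (κ + 1) (κ + 1 + j) *ᵥ
        (μ[x (κ + 1) | info ξ dw (D.lag κ (min (D.d₁ - D.d₂) (j + 1)))]) ω := by
    rw [← sum_Icc_pred (fun j => S.Ph i (κ + 1) (κ + 1 + j) *ᵥ
        (μ[x (κ + 1) | info ξ dw (D.lag κ (min (D.d₁ - D.d₂) (j + 1)))]) ω) le_rfl]
    refine Finset.sum_congr rfl fun j hj => ?_
    rw [Finset.mem_Icc] at hj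
    rw [Nat.sub_add_cancel hj.1, min_eq_right (by omega), Nat.add_sub_assoc hj.1]
  have e2 : ∑ j ∈ Finset.Ico (D.d₁ - D.d₂ - 1) D.d₁, S.Ph i (κ + 1) (κ + 1 + j) *ᵥ
        (μ[x (κ + 1) | info ξ dw (D.lag κ (min (D.d₁ - D.d₂) (j + 1)))]) ω =
      (∑ j ∈ Finset.Ico (D.d₁ - D.d₂ - 1) D.d₁, S.Ph i (κ + 1) (κ + 1 + j)) *ᵥ
        (μ[x (κ + 1) | info ξ dw (D.lag κ (D.d₁ - D.d₂))]) ω := by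
    rw [Matrix.sum_mulVec]
    refine Finset.sum_congr rfl fun j hj => ?_
    rw [Finset.mem_Ico] at hj
    rw [min_eq_left (by omega)]
  dsimp only
  rw [e1, Finset.range_eq_Ico,
    ← Finset.sum_Ico_consecutive _ (Nat.zero_le _) (by omega : D.d₁ - D.d₂ - 1 ≤ D.d₁), e2, Sc,
    partialS, ← Matrix.sum_mulVec, Matrix.add_mulVec, Matrix.add_mulVec, Finset.range_eq_Ico]
  abel

/-- The forward equation once the adjoint processes are expressed by estimates of the state. -/
theorem HasFeedback.forward (h : D.HasFeedback S μ ξ dw x p κ)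
    (hdw : IsNoise μ D.δ D.N ξ dw) (hsol : D.IsSolution μ ξ dw x p) (hd : D.d₂ < D.d₁)
    (hκ : κ ≤ D.N) : ∀ᵐ ω ∂μ, x (κ + 1) ω = D.rA (dw κ ω) *ᵥ x κ ω
      + D.rB11 (dw κ ω) *ᵥ (D.Sh S 0 (κ + 1) *ᵥ (μ[x (κ + 1) | info ξ dw (D.lag κ 0)]) ω)
      + D.rB12 (dw κ ω) *ᵥ
        (D.Sc S 1 (κ + 1) *ᵥ (μ[x (κ + 1) | info ξ dw (D.lag κ (D.d₁ - D.d₂))]) ω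
          + ∑ j ∈ Finset.Icc 1 (D.d₁ - D.d₂ - 1), S.Ph 1 (κ + 1) (κ + 1 + j - 1) *ᵥ
            (μ[x (κ + 1) | info ξ dw (D.lag κ j)]) ω)
      + (1 / D.δ) • (D.rB21 (dw κ ω) *ᵥ (S.P 0 (κ + 1) *ᵥ
          (μ[fun ω => dw κ ω • x (κ + 1) ω | info ξ dw (D.lag κ 0)]) ω))
      + (1 / D.δ) • (D.rB22 (dw κ ω) *ᵥ (S.P 1 (κ + 1) *ᵥ
          (μ[fun ω => dw κ ω • x (κ + 1) ω | info ξ dw (D.lag κ (D.d₁ - D.d₂))]) ω)) := by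
  filter_upwards [hsol.forward κ hκ, h.condExp_zero hdw hsol hd hκ 0,
    h.condExp_delay hdw hsol hd hκ 1, (h.hasCondExp_smul hdw hsol hd hκ 0 (Nat.zero_le _)).2,
    (h.hasCondExp_smul hdw hsol hd hκ 1 (by omega : D.d₁ - D.d₂ ≤ D.d₁)).2] with ω h0 h1 h2 h3 h4
  rw [lag_delay₁, lag_delay₂ D κ hd, h1, h2, h3, h4] at h0
  exact h0

theorem HasFeedback.block_system (h : D.HasFeedback S μ ξ dw x p κ) (hδ : D.δ ≠ 0)
    (hdw : IsNoise μ D.δ D.N ξ dw) (hsol : D.IsSolution μ ξ dw x p) (hd : D.d₂ < D.d₁)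
    (hκ : κ ≤ D.N) {r : ℕ} (hr : r ≤ D.d₁ - D.d₂) {Y : ℕ → Ω → Fin n ⊕ Fin n → ℝ}
    (hY : ∀ r ω, Y r ω = Sum.elim ((μ[x (κ + 1) | info ξ dw (D.lag κ r)]) ω)
      ((μ[fun ω => dw κ ω • x (κ + 1) ω | info ξ dw (D.lag κ r)]) ω)) :
    ∀ᵐ ω ∂μ, Y r ω = D.colA *ᵥ (μ[x κ | info ξ dw (D.lag κ r)]) ω + D.G S (κ + 1) *ᵥ Y 0 ω
      + (1 - D.Gammac S (κ + 1)) *ᵥ Y r ω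
      + D.blockB *ᵥ ∑ j ∈ Finset.Icc 1 (D.d₁ - D.d₂ - 1),
          blockP S (κ + 1) j *ᵥ Y (min r j) ω := by
  have hf := hdw.isFresh hκ
  have hlag : info ξ dw (D.lag κ r) ≤ info ξ dw ((κ : ℤ) - 1) :=
    info_mono (D.lag_le κ (by omega))
  have hx := hsol.adapted κ (by omega)
  have hxi : HasCondExp (info ξ dw (D.lag κ r)) μ _ _ := .refl (hsol.integrable_x (by omega : κ ≤ _))
  have am {s : ℕ} (hs : s ≤ D.d₁) (f : Ω → Fin n → ℝ) :
      AEStronglyMeasurable[info ξ dw ((κ : ℤ) - 1)] (μ[f | info ξ dw (D.lag κ s)]) μ :=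
    aestronglyMeasurable_condExp_info (D.lag_le κ hs) f
  have ce {s : ℕ} (hs : s ≤ D.d₁) (f : Ω → Fin n → ℝ) : HasCondExp (info ξ dw (D.lag κ r)) μ
      (μ[f | info ξ dw (D.lag κ s)]) (μ[f | info ξ dw (D.lag κ (min r s))]) := by
    rw [← min_lag]
    have h1 := D.lag_le κ hs
    have h2 := D.lag_le κ (by omega : r ≤ D.d₁)
    exact hdw.hasCondExp_condExp (by omega) (by omega) f
  have am0 := (am (Nat.zero_le _) (x (κ + 1))).const_mulVec (D.Sh S 0 (κ + 1))
  have ce0 := (ce (Nat.zero_le _) (x (κ + 1))).mulVec (D.Sh S 0 (κ + 1))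
  have am1 := ((am (by omega : D.d₁ - D.d₂ ≤ D.d₁) (x (κ + 1))).const_mulVec
    (D.Sc S 1 (κ + 1))).add (AEStronglyMeasurable.finsetSum
      (Finset.Icc 1 (D.d₁ - D.d₂ - 1)) fun j hj => (am (s := j)
        (by rw [Finset.mem_Icc] at hj; omega) (x (κ + 1))).const_mulVec
          (S.Ph 1 (κ + 1) (κ + 1 + j - 1)))
  have ce1 := ((ce (by omega : D.d₁ - D.d₂ ≤ D.d₁) (x (κ + 1))).mulVec
    (D.Sc S 1 (κ + 1))).add (.sum (Finset.Icc 1 (D.d₁ - D.d₂ - 1)) fun j hj => (ce (s := j)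
        (by rw [Finset.mem_Icc] at hj; omega) (x (κ + 1))).mulVec
          (S.Ph 1 (κ + 1) (κ + 1 + j - 1)))
  have am2 := (am (Nat.zero_le _) (fun ω => dw κ ω • x (κ + 1) ω)).const_mulVec (S.P 0 (κ + 1))
  have ce2 := (ce (Nat.zero_le _) (fun ω => dw κ ω • x (κ + 1) ω)).mulVec (S.P 0 (κ + 1))
  have am3 := (am (by omega : D.d₁ - D.d₂ ≤ D.d₁)
    (fun ω => dw κ ω • x (κ + 1) ω)).const_mulVec (S.P 1 (κ + 1))
  have ce3 := (ce (by omega : D.d₁ - D.d₂ ≤ D.d₁)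
    (fun ω => dw κ ω • x (κ + 1) ω)).mulVec (S.P 1 (κ + 1))
  rw [Nat.min_zero] at ce0 ce2
  rw [min_eq_left hr] at ce1 ce3
  have hX := ((((hf.hasCondExp_mulVec hlag D.isAffine_rA.isQuadratic hx hxi).add
    (hf.hasCondExp_mulVec hlag D.isAffine_rB11.isQuadratic am0 ce0)).add
    (hf.hasCondExp_mulVec hlag D.isAffine_rB12.isQuadratic am1 ce1)).add
    ((hf.hasCondExp_mulVec hlag D.isAffine_rB21.isQuadratic am2 ce2).smul (1 / D.δ))).add
    ((hf.hasCondExp_mulVec hlag D.isAffine_rB22.isQuadratic am3 ce3).smul (1 / D.δ))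
  have hW := ((((hf.hasCondExp_mulVec hlag D.isAffine_rA.smul_id hx hxi).add
    (hf.hasCondExp_mulVec hlag D.isAffine_rB11.smul_id am0 ce0)).add
    (hf.hasCondExp_mulVec hlag D.isAffine_rB12.smul_id am1 ce1)).add
    ((hf.hasCondExp_mulVec hlag D.isAffine_rB21.smul_id am2 ce2).smul (1 / D.δ))).add
    ((hf.hasCondExp_mulVec hlag D.isAffine_rB22.smul_id am3 ce3).smul (1 / D.δ))
  have hfw := h.forward hdw hsol hd hκ
  have hX' := hX.congr hfw .rfl
  -- The product of `dw κ` with the forward equation has coefficients quadratic in the noise.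
  have hW' := hW.congr (f' := fun ω => dw κ ω • x (κ + 1) ω) (by
    filter_upwards [hfw] with ω hω
    nth_rw 1 [hω]
    simp only [Matrix.smul_mulVec, smul_add, smul_comm (dw κ ω) (1 / D.δ), Pi.add_apply]) .rfl
  simp only [rA, rB11, rB12, rB21, rB22, hf.matExp_affine] at hX'
  simp only [rA, rB11, rB12, rB21, rB22, hf.matExp_smul_affine] at hW'
  filter_upwards [hX'.2, hW'.2] with ω hωX hωW
  simp only [hY]
  exact DelayGame.block_system D S hδ (κ + 1) (fun r => (μ[x (κ + 1) | info ξ dw (D.lag κ r)]) ω)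
    (fun r => (μ[fun ω => dw κ ω • x (κ + 1) ω | info ξ dw (D.lag κ r)]) ω)
    (fun r => (μ[x κ | info ξ dw (D.lag κ r)]) ω) r hωX hωW

theorem HasFeedback.closedLoop (h : D.HasFeedback S μ ξ dw x p κ) (hδ : D.δ ≠ 0)
    (hdw : IsNoise μ D.δ D.N ξ dw) (hsol : D.IsSolution μ ξ dw x p) (hd : D.d₂ < D.d₁)
    (hκ : κ ≤ D.N) (hΓh : IsUnit (D.Gammah S (κ + 1)))
    (hΓ : ∀ m, 1 ≤ m → m < D.d₁ - D.d₂ → IsUnit (D.Gamma S (κ + 1) m))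
    (hΓc : IsUnit (D.Gammac S (κ + 1))) :
    ∀ᵐ ω ∂μ, x (κ + 1) ω = D.rA (dw κ ω) *ᵥ x κ ω
      + D.M S κ (dw κ ω) *ᵥ (μ[x κ | info ξ dw (D.lag κ 0)]) ω
      + ∑ m ∈ Finset.Icc 1 (D.d₁ - D.d₂ - 1),
          D.Mm S κ m (dw κ ω) *ᵥ (μ[x κ | info ξ dw (D.lag κ m)]) ω
      + D.Hm S κ (dw κ ω) *ᵥ (μ[x κ | info ξ dw (D.lag κ (D.d₁ - D.d₂))]) ω := by
  let Y : ℕ → Ω → Fin n ⊕ Fin n → ℝ := fun r ω =>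
    Sum.elim ((μ[x (κ + 1) | info ξ dw (D.lag κ r)]) ω)
      ((μ[fun ω => dw κ ω • x (κ + 1) ω | info ξ dw (D.lag κ r)]) ω)
  -- The solution of the system is pathwise, so one null set must serve all indices `r`.
  have hsys := ae_all_iff.2 fun r : ℕ => ae_all_iff.2 fun hr : r ≤ D.d₁ - D.d₂ =>
    h.block_system hδ hdw hsol hd hκ hr (Y := Y) fun _ _ => rfl
  filter_upwards [h.forward hdw hsol hd hκ, hsys] with ω hω hYω
  have key := D.closedLoop_of_system S κ (dw κ ω) (fun r => Y r ω)
    (fun r => (μ[x κ | info ξ dw (D.lag κ r)]) ω) hd hΓh hΓ hΓc hYω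
  simp only [Y, blockP_mulVec, sumElim_finsetSum, row1, row2, Matrix.fromCols_mulVec_sumElim,
    Matrix.zero_mulVec, Matrix.smul_mulVec, ← Matrix.mulVec_mulVec] at key
  rw [hω, add_assoc _ (D.M S κ _ *ᵥ _), add_assoc _ (_ + _), ← key, Matrix.mulVec_add]
  abel

end DelayGame

/-! ### Expectations of sums, and rearrangement of the coefficients -/

theorem IsAffine.sum {a b ι : Type*} (s : Finset ι) {F : ι → ℝ → Matrix a b ℝ}
    (h : ∀ i ∈ s, IsAffine (F i)) : IsAffine fun z => ∑ i ∈ s, F i z := by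
  classical
  induction s using Finset.induction_on with
  | empty => simpa using isAffine_const 0
  | insert i s hi ih =>
    simp only [Finset.sum_insert hi]
    exact (h i (by simp)).add (ih fun j hj => h j (by simp [hj]))

theorem IsAffine.const_mul {a b c : Type*} [Fintype b] (C : Matrix a b ℝ)
    {F : ℝ → Matrix b c ℝ} (h : IsAffine F) : IsAffine fun z => C * F z := by
  obtain ⟨C₀, C₁, h⟩ := h
  exact ⟨C * C₀, C * C₁, fun z => by simp only [h, Matrix.mul_add, Matrix.mul_smul]⟩

section MatExp

variable {Ω : Type*} {m mΩ : MeasurableSpace Ω} {μ : Measure Ω} [IsProbabilityMeasure μ]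
  {w : Ω → ℝ} {δ : ℝ} {a b : Type*}

theorem matExp_const (C : Matrix a b ℝ) : matExp μ (fun _ => C) = C := by
  ext; simp [matExp]

theorem IsFresh.matExp_sum (h : IsFresh m μ w δ) {ι : Type*} (s : Finset ι)
    {F : ι → ℝ → Matrix a b ℝ} (hF : ∀ i ∈ s, IsAffine (F i)) :
    matExp μ (fun ω => ∑ i ∈ s, F i (w ω)) = ∑ i ∈ s, matExp μ (fun ω => F i (w ω)) := by
  classical
  induction s using Finset.induction_on with
  | empty => simpa using matExp_const 0
  | insert i s hi ih =>
    have hs : ∀ j ∈ s, IsAffine (F j) := fun j hj => hF j (by simp [hj])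
    simp only [Finset.sum_insert hi]
    rw [h.matExp_add (hF i (by simp)).isQuadratic (IsAffine.sum s hs).isQuadratic, ih hs]

end MatExp

theorem sum_range_shift {M : Type*} [AddCommMonoid M] (g : ℕ → M) {b : ℕ} (hb : 0 < b) :
    ∑ j ∈ Finset.range b, g (j + 1) = ∑ j ∈ Finset.Ico 1 b, g j + g b := by
  rw [Finset.range_eq_Ico, Finset.sum_Ico_add' g 0 b 1, zero_add, Finset.sum_Ico_succ_top hb]

/-- The exchange puts `m = j + 1`. Truncated subtraction makes the rows `r = 0` and `r = 1` empty.
-/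
theorem sum_triangle {M : Type*} [AddCommMonoid M] (F : ℕ → ℕ → M) (d : ℕ) :
    ∑ r ∈ Finset.range (d + 1), ∑ j ∈ Finset.range (r - 1), F r j =
      ∑ m ∈ Finset.Ico 1 d, ∑ r ∈ Finset.Ico (m + 1) (d + 1), F r (m - 1) := by
  rw [Finset.sum_Ico_eq_sum_range]
  simp only [add_comm 1, Nat.add_sub_cancel]
  refine Finset.sum_comm' fun r j => ?_
  simp only [Finset.mem_range, Finset.mem_Ico]
  omega

theorem sum_range_succ_eq_ends {M : Type*} [AddCommMonoid M] (g : ℕ → M) {d : ℕ} (hd : 0 < d) :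
    ∑ r ∈ Finset.range (d + 1), g r = g 0 + ∑ m ∈ Finset.Ico 1 d, g m + g d := by
  rw [Finset.sum_range_succ, Finset.range_eq_Ico, Finset.sum_eq_sum_Ico_succ_bot hd]

/-- Collecting the coefficients of the estimates `U r` after one backward step. -/
theorem collect_estimates {ι : Type*} [Fintype ι] {d d₂ : ℕ} (hd : 0 < d) (hd₂ : 0 < d₂)
    (A : Matrix ι ι ℝ) (ph pc R C Ph Pc : ℕ → Matrix ι ι ℝ) (U : ℕ → ι → ℝ)
    (hPh0 : Ph 0 = R 0 + (∑ j ∈ Finset.Ico 0 (d + d₂), ph j + ∑ j ∈ Finset.range d₂, pc j) * C 0)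
    (hPhs : ∀ m, 1 ≤ m → m < d → Ph m = R m
      + (∑ j ∈ Finset.Ico (m - 1) (d + d₂), ph j + ∑ j ∈ Finset.range d₂, pc j) * C m
      + ph (m - 1) * (A + ∑ r ∈ Finset.Ico (m + 1) (d + 1), C r))
    (hPhl : ∀ m, d ≤ m → m < d + d₂ → Ph m = ph (m - 1) * A)
    (hPc0 : Pc 0 = R d
      + (∑ j ∈ Finset.Ico (d - 1) (d + d₂), ph j + ∑ j ∈ Finset.range d₂, pc j) * C d)
    (hPcl : ∀ m, 1 ≤ m → m < d₂ → Pc m = pc (m - 1) * A) :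
    ∑ r ∈ Finset.range (d + 1), R r *ᵥ U r
      + ∑ j ∈ Finset.range (d + d₂), ph j *ᵥ
        (A *ᵥ U (j + 1) + ∑ r ∈ Finset.range (d + 1), C r *ᵥ U (min (j + 1) r))
      + ∑ j ∈ Finset.range d₂, pc j *ᵥ
        (A *ᵥ U (d + j + 1) + ∑ r ∈ Finset.range (d + 1), C r *ᵥ U r) =
    ((ph (d + d₂ - 1) + pc (d₂ - 1)) * A) *ᵥ U (d + d₂)
      + ∑ j ∈ Finset.range (d + d₂), Ph j *ᵥ U j + ∑ j ∈ Finset.range d₂, Pc j *ᵥ U (d + j) := by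
  have e1 : ∑ j ∈ Finset.range (d + d₂), ph j *ᵥ (A *ᵥ U (j + 1)) =
      ∑ m ∈ Finset.Ico 1 d, (ph (m - 1) * A) *ᵥ U m
        + ∑ m ∈ Finset.Ico d (d + d₂), (ph (m - 1) * A) *ᵥ U m
        + (ph (d + d₂ - 1) * A) *ᵥ U (d + d₂) := by
    rw [Finset.sum_Ico_consecutive _ (by omega : 1 ≤ d) (by omega : d ≤ d + d₂),
      ← sum_range_shift (fun m => (ph (m - 1) * A) *ᵥ U m) (by omega)]
    simp [Matrix.mulVec_mulVec]
  have e2 : ∑ j ∈ Finset.range d₂, pc j *ᵥ (A *ᵥ U (d + j + 1)) =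
      ∑ m ∈ Finset.Ico 1 d₂, (pc (m - 1) * A) *ᵥ U (d + m)
        + (pc (d₂ - 1) * A) *ᵥ U (d + d₂) := by
    rw [← sum_range_shift (fun m => (pc (m - 1) * A) *ᵥ U (d + m)) hd₂]
    simp [Matrix.mulVec_mulVec, add_assoc]
  -- Split at `j = r - 1`: from there on the minimum is `r` and the term belongs to `U r`; below, it
  -- is `j + 1` and the term is re-indexed by `m = j + 1`.
  have e3 : ∑ j ∈ Finset.range (d + d₂), ph j *ᵥ
        (∑ r ∈ Finset.range (d + 1), C r *ᵥ U (min (j + 1) r)) =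
      ∑ r ∈ Finset.range (d + 1), ((∑ j ∈ Finset.Ico (r - 1) (d + d₂), ph j) * C r) *ᵥ U r
      + ∑ m ∈ Finset.Ico 1 d,
        (ph (m - 1) * ∑ r ∈ Finset.Ico (m + 1) (d + 1), C r) *ᵥ U m := by
    have ht : ∑ m ∈ Finset.Ico 1 d, (ph (m - 1) * ∑ r ∈ Finset.Ico (m + 1) (d + 1), C r) *ᵥ U m =
        ∑ m ∈ Finset.Ico 1 d, ∑ r ∈ Finset.Ico (m + 1) (d + 1),
          (ph (m - 1) * C r) *ᵥ U (m - 1 + 1) := by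
      refine Finset.sum_congr rfl fun m hm => ?_
      rw [Finset.mem_Ico] at hm
      rw [Finset.mul_sum, Matrix.sum_mulVec, Nat.sub_add_cancel hm.1]
    rw [ht, ← sum_triangle (fun r j => (ph j * C r) *ᵥ U (j + 1)), ← Finset.sum_add_distrib]
    simp only [Matrix.mulVec_sum, Matrix.mulVec_mulVec]
    rw [Finset.sum_comm]
    refine Finset.sum_congr rfl fun r hr => ?_
    rw [Finset.mem_range] at hr
    rw [Finset.range_eq_Ico,
      ← Finset.sum_Ico_consecutive _ (Nat.zero_le (r - 1)) (by omega : r - 1 ≤ d + d₂), add_comm,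
      Finset.sum_mul, Matrix.sum_mulVec]
    congr 1
    · refine Finset.sum_congr rfl fun j hj => ?_
      rw [Finset.mem_Ico] at hj
      rw [min_eq_right (by omega)]
    · rw [← Finset.range_eq_Ico]
      refine Finset.sum_congr rfl fun j hj => ?_
      rw [Finset.mem_range] at hj
      rw [min_eq_left (by omega)]
  have e4 : ∑ j ∈ Finset.range d₂, pc j *ᵥ (∑ r ∈ Finset.range (d + 1), C r *ᵥ U r) =
      ∑ r ∈ Finset.range (d + 1), ((∑ j ∈ Finset.range d₂, pc j) * C r) *ᵥ U r := by
    rw [← Matrix.sum_mulVec, Matrix.mulVec_sum]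
    simp only [Matrix.mulVec_mulVec]
  have e5 : ∑ j ∈ Finset.range (d + d₂), Ph j *ᵥ U j = Ph 0 *ᵥ U 0
      + ∑ m ∈ Finset.Ico 1 d, Ph m *ᵥ U m + ∑ m ∈ Finset.Ico d (d + d₂), Ph m *ᵥ U m := by
    rw [Finset.range_eq_Ico, ← Finset.sum_Ico_consecutive _ (Nat.zero_le d) (by omega),
      Finset.sum_eq_sum_Ico_succ_bot hd]
  have e6 : ∑ j ∈ Finset.range d₂, Pc j *ᵥ U (d + j) =
      Pc 0 *ᵥ U d + ∑ m ∈ Finset.Ico 1 d₂, Pc m *ᵥ U (d + m) := by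
    rw [Finset.range_eq_Ico, Finset.sum_eq_sum_Ico_succ_bot hd₂]
    rfl
  have f1 : ∑ m ∈ Finset.Ico 1 d, Ph m *ᵥ U m = ∑ m ∈ Finset.Ico 1 d, (R m *ᵥ U m
      + ((∑ j ∈ Finset.Ico (m - 1) (d + d₂), ph j) * C m) *ᵥ U m
      + ((∑ j ∈ Finset.range d₂, pc j) * C m) *ᵥ U m + (ph (m - 1) * A) *ᵥ U m
      + (ph (m - 1) * ∑ r ∈ Finset.Ico (m + 1) (d + 1), C r) *ᵥ U m) := by
    refine Finset.sum_congr rfl fun m hm => ?_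
    rw [Finset.mem_Ico] at hm
    rw [hPhs m hm.1 hm.2, Matrix.add_mul, Matrix.mul_add]
    simp only [Matrix.add_mulVec]
    abel
  have f2 : ∑ m ∈ Finset.Ico d (d + d₂), Ph m *ᵥ U m =
      ∑ m ∈ Finset.Ico d (d + d₂), (ph (m - 1) * A) *ᵥ U m := by
    refine Finset.sum_congr rfl fun m hm => ?_
    rw [Finset.mem_Ico] at hm
    rw [hPhl m hm.1 hm.2]
  have f3 : ∑ m ∈ Finset.Ico 1 d₂, Pc m *ᵥ U (d + m) =
      ∑ m ∈ Finset.Ico 1 d₂, (pc (m - 1) * A) *ᵥ U (d + m) := by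
    refine Finset.sum_congr rfl fun m hm => ?_
    rw [Finset.mem_Ico] at hm
    rw [hPcl m hm.1 hm.2]
  rw [e5, e6, f1, f2, f3, hPh0, hPc0]
  simp only [Matrix.mulVec_add, Finset.sum_add_distrib, e1, e2, e3, e4]
  simp only [sum_range_succ_eq_ends _ hd, Matrix.add_mul, Matrix.add_mulVec, Nat.zero_sub]
  abel

/-! ### The Riccati recursions in terms of the closed-loop coefficients -/

namespace DelayGame

variable {n m₁ m₂ : ℕ} (D : DelayGame n m₁ m₂) (S : RiccatiFamily n)

/-- The coefficient of the estimate of `x k` at lag `r` in the closed loop, for `r ≤ d₁ - d₂`. -/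
def loopCoef (k r : ℕ) (z : ℝ) : Matrix (Fin n) (Fin n) ℝ :=
  if r = 0 then D.M S k z else if r < D.d₁ - D.d₂ then D.Mm S k r z else D.Hm S k z

theorem loopCoef_zero (k : ℕ) (z : ℝ) : D.loopCoef S k 0 z = D.M S k z := if_pos rfl

theorem loopCoef_delay (hd : D.d₂ < D.d₁) (k : ℕ) (z : ℝ) :
    D.loopCoef S k (D.d₁ - D.d₂) z = D.Hm S k z := by
  rw [loopCoef, if_neg (by omega), if_neg (by omega)]

theorem loopCoef_of_lt (k : ℕ) {r : ℕ} (h0 : 1 ≤ r) (h : r < D.d₁ - D.d₂) (z : ℝ) :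
    D.loopCoef S k r z = D.Mm S k r z := by
  rw [loopCoef, if_neg (by omega), if_pos h]

theorem isAffine_row1 (k : ℕ) : IsAffine (D.row1 S k) :=
  (D.isAffine_rB11.mul_const _).fromCols ((D.isAffine_rB21.mul_const _).smul _)

theorem isAffine_row2 (k : ℕ) : IsAffine (D.row2 S k) :=
  (D.isAffine_rB12.mul_const _).fromCols ((D.isAffine_rB22.mul_const _).smul _)

theorem isAffine_bracket (k : ℕ) : IsAffine (D.bracket S k) :=
  (D.isAffine_rB12.fromCols (isAffine_const 0)).add
    (((D.isAffine_row2 S k).mul_const _).mul_const _)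

theorem isAffine_M (k : ℕ) : IsAffine (D.M S k) :=
  ((((D.isAffine_row1 S k).add (((D.isAffine_row2 S k).mul_const _).mul_const _)).add
    (((D.isAffine_bracket S k).mul_const _).mul_const _)).mul_const _).mul_const _

theorem isAffine_Mm (k m : ℕ) : IsAffine (D.Mm S k m) := by
  by_cases h : m < D.d₁ - D.d₂
  · rw [show D.Mm S k m = fun z => D.bracket S k z * D.Z S (k + 1) m * D.K S (k + 1) m * D.colA
      from funext fun _ => if_pos h]
    exact (((D.isAffine_bracket S k).mul_const _).mul_const _).mul_const _
  · rw [show D.Mm S k m = fun _ => 0 from funext fun _ => if_neg h]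
    exact isAffine_const 0

theorem isAffine_Hm (k : ℕ) : IsAffine (D.Hm S k) :=
  ((D.isAffine_row2 S k).mul_const _).mul_const _

theorem isAffine_loopCoef (k r : ℕ) : IsAffine (D.loopCoef S k r) := by
  unfold loopCoef
  split_ifs
  exacts [D.isAffine_M S k, D.isAffine_Mm S k r, D.isAffine_Hm S k]

theorem sum_loopCoef_mulVec (hd : D.d₂ < D.d₁) (k : ℕ) (z : ℝ) (U : ℕ → Fin n → ℝ) :
    ∑ r ∈ Finset.range (D.d₁ - D.d₂ + 1), D.loopCoef S k r z *ᵥ U r = D.M S k z *ᵥ U 0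
      + ∑ m ∈ Finset.Icc 1 (D.d₁ - D.d₂ - 1), D.Mm S k m z *ᵥ U m
      + D.Hm S k z *ᵥ U (D.d₁ - D.d₂) := by
  have hI : Finset.Icc 1 (D.d₁ - D.d₂ - 1) = Finset.Ico 1 (D.d₁ - D.d₂) := by
    ext j; simp only [Finset.mem_Icc, Finset.mem_Ico]; omega
  rw [sum_range_succ_eq_ends _ (by omega), hI, loopCoef_zero, loopCoef_delay D S hd]
  congr 2
  refine Finset.sum_congr rfl fun j hj => ?_
  rw [Finset.mem_Ico] at hj
  rw [loopCoef_of_lt D S k hj.1 hj.2]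

theorem partialS_eq (i : Fin 2) (k l : ℕ) : D.partialS S i k l = S.P i k
    + (∑ j ∈ Finset.Ico l D.d₁, S.Ph i k (k + j) + ∑ j ∈ Finset.range D.d₂, S.Pc i k (k + j)) := by
  rw [partialS, add_assoc]

variable {Ω : Type*} {m mΩ : MeasurableSpace Ω} {μ : Measure Ω} [IsProbabilityMeasure μ]
  {w : Ω → ℝ}

/-- The first factor is `(rA w)ᵀ P + Âᵀ X`: `P` multiplies the true state, which meets the noise,
while `X` multiplies estimates, which see only the mean `Âᵀ`. -/
theorem matExp_riccati (h : IsFresh m μ w D.δ) (P X : Matrix (Fin n) (Fin n) ℝ)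
    {C : ℝ → Matrix (Fin n) (Fin n) ℝ} (hC : IsAffine C) :
    matExp μ (fun ω => (D.Ahᵀ * (P + X) + w ω • (D.Abᵀ * P)) * C (w ω)) =
      matExp μ (fun ω => (D.rA (w ω))ᵀ * P * C (w ω))
        + D.Ahᵀ * X * matExp μ (fun ω => C (w ω)) := by
  have hA : IsAffine fun z => (D.rA z)ᵀ * P := D.isAffine_rA.transpose.mul_const P
  rw [← h.matExp_const_mul _ hC.isQuadratic,
    ← h.matExp_add (hA.mul hC) (hC.const_mul _).isQuadratic]
  congr 1
  ext1 ω
  simp only [rA, Matrix.transpose_add, Matrix.transpose_smul, Matrix.mul_add, Matrix.add_mul,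
    Matrix.smul_mul]
  abel

theorem matExp_conj_rA (h : IsFresh m μ w D.δ) (P : Matrix (Fin n) (Fin n) ℝ) :
    matExp μ (fun ω => (D.rA (w ω))ᵀ * P * D.rA (w ω)) =
      D.Ahᵀ * P * D.Ah + D.δ • (D.Abᵀ * P * D.Ab) := by
  rw [← h.matExp_quadratic _ (D.Ahᵀ * P * D.Ab + D.Abᵀ * P * D.Ah)]
  congr 1
  ext1 ω
  simp only [rA, Matrix.transpose_add, Matrix.transpose_smul, Matrix.mul_add, Matrix.add_mul,
    Matrix.smul_mul, Matrix.mul_smul, smul_smul, sq, smul_add]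
  abel

variable {S D} {dw : ℕ → Ω → ℝ} {κ : ℕ}

theorem IsRiccati.eq_Ph_zero' (hS : D.IsRiccati S μ dw)
    (hf : IsFresh m μ (dw κ) D.δ) (h1 : D.d₁ ≤ κ) (h2 : κ ≤ D.N) (i : Fin 2) :
    S.Ph i κ κ =
      matExp μ (fun ω => (D.rA (dw κ ω))ᵀ * S.P i (κ + 1) * D.loopCoef S κ 0 (dw κ ω))
      + D.Ahᵀ * (∑ j ∈ Finset.Ico 0 D.d₁, S.Ph i (κ + 1) (κ + 1 + j)
        + ∑ j ∈ Finset.range D.d₂, S.Pc i (κ + 1) (κ + 1 + j))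
        * matExp μ (fun ω => D.loopCoef S κ 0 (dw κ ω)) := by
  rw [hS.eq_Ph_zero i κ h1 h2, Sh, partialS_eq, matExp_riccati D hf _ _ (D.isAffine_M S κ)]
  simp only [loopCoef_zero]

theorem IsRiccati.eq_Pc_zero' (hS : D.IsRiccati S μ dw)
    (hf : IsFresh m μ (dw κ) D.δ) (hd : D.d₂ < D.d₁) (h1 : D.d₁ ≤ κ) (h2 : κ ≤ D.N) (i : Fin 2) :
    S.Pc i κ κ =
      matExp μ (fun ω =>
        (D.rA (dw κ ω))ᵀ * S.P i (κ + 1) * D.loopCoef S κ (D.d₁ - D.d₂) (dw κ ω))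
      + D.Ahᵀ * (∑ j ∈ Finset.Ico (D.d₁ - D.d₂ - 1) D.d₁, S.Ph i (κ + 1) (κ + 1 + j)
        + ∑ j ∈ Finset.range D.d₂, S.Pc i (κ + 1) (κ + 1 + j))
        * matExp μ (fun ω => D.loopCoef S κ (D.d₁ - D.d₂) (dw κ ω)) := by
  rw [hS.eq_Pc_zero i κ h1 h2, Sc, partialS_eq, matExp_riccati D hf _ _ (D.isAffine_Hm S κ)]
  simp only [loopCoef_delay D S hd]

/-- Compared with `eq_Ph_small`, the product of `Ph` number `r - 1` with the mean of `Mm` number `r`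
is moved out of the last bracket. It completes the sum in the partial `S`, which then starts at `r -
1` as `collect_estimates` requires. -/
theorem IsRiccati.eq_Ph_small' (hS : D.IsRiccati S μ dw)
    (hf : IsFresh m μ (dw κ) D.δ) (hd : D.d₂ < D.d₁) (h1 : D.d₁ ≤ κ) (h2 : κ ≤ D.N) (i : Fin 2)
    {r : ℕ} (hr : 1 ≤ r) (hr' : r < D.d₁ - D.d₂) :
    S.Ph i κ (κ + r) =
      matExp μ (fun ω => (D.rA (dw κ ω))ᵀ * S.P i (κ + 1) * D.loopCoef S κ r (dw κ ω))
      + D.Ahᵀ * (∑ j ∈ Finset.Ico (r - 1) D.d₁, S.Ph i (κ + 1) (κ + 1 + j)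
        + ∑ j ∈ Finset.range D.d₂, S.Pc i (κ + 1) (κ + 1 + j))
        * matExp μ (fun ω => D.loopCoef S κ r (dw κ ω))
      + D.Ahᵀ * S.Ph i (κ + 1) (κ + 1 + (r - 1)) * (D.Ah
        + ∑ s ∈ Finset.Ico (r + 1) (D.d₁ - D.d₂ + 1),
          matExp μ (fun ω => D.loopCoef S κ s (dw κ ω))) := by
  have hI : Finset.Icc r (D.d₁ - D.d₂ - 1) = Finset.Ico r (D.d₁ - D.d₂) := by
    ext j; simp only [Finset.mem_Icc, Finset.mem_Ico]; omega
  have hsum (z : ℝ) : D.Ah + D.Hm S κ z + ∑ j ∈ Finset.Icc r (D.d₁ - D.d₂ - 1), D.Mm S κ j z =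
      D.Ah + ∑ j ∈ Finset.Ico r (D.d₁ - D.d₂ + 1), D.loopCoef S κ j z := by
    rw [Finset.sum_Ico_succ_top hr'.le, loopCoef_delay D S hd, hI, add_assoc,
      add_comm (D.Hm S κ z)]
    congr 2
    refine Finset.sum_congr rfl fun j hj => ?_
    rw [Finset.mem_Ico] at hj
    rw [loopCoef_of_lt D S κ (by omega) hj.2]
  have hl (j : ℕ) (_ : j ∈ Finset.Ico r (D.d₁ - D.d₂ + 1)) : IsAffine (D.loopCoef S κ j) :=
    D.isAffine_loopCoef S κ j
  have hL := IsAffine.sum _ hl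
  have hA : IsAffine fun z => D.Ahᵀ * D.Sm S i (κ + 1) (r + 1) + z • (D.Abᵀ * S.P i (κ + 1)) :=
    ⟨_, _, fun _ => rfl⟩
  rw [hS.eq_Ph_small i κ r h1 h2 hr hr']
  simp only [hsum]
  rw [hf.matExp_add (hA.mul (D.isAffine_Mm S κ r))
      (((isAffine_const D.Ah).add hL).const_mul _).isQuadratic,
    hf.matExp_const_mul _ ((isAffine_const D.Ah).add hL).isQuadratic,
    hf.matExp_add (isAffine_const D.Ah).isQuadratic hL.isQuadratic, matExp_const,
    hf.matExp_sum _ hl, Sm, partialS_eq, matExp_riccati D hf _ _ (D.isAffine_Mm S κ r),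
    Finset.sum_eq_sum_Ico_succ_bot (by omega : r < D.d₁ - D.d₂ + 1), Nat.add_sub_cancel,
    Finset.sum_eq_sum_Ico_succ_bot (by omega : r - 1 < D.d₁), Nat.sub_add_cancel hr,
    show κ + 1 + (r - 1) = κ + r by omega]
  simp only [loopCoef_of_lt D S κ hr hr']
  simp only [Matrix.mul_add, Matrix.add_mul]
  abel

end DelayGame

/-! ### The backward step -/

namespace DelayGame

variable {n m₁ m₂ : ℕ} {D : DelayGame n m₁ m₂} {S : RiccatiFamily n}
  {Ω : Type*} {mΩ : MeasurableSpace Ω} {μ : Measure Ω} [IsProbabilityMeasure μ]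
  {ξ : Ω → Fin n → ℝ} {dw : ℕ → Ω → ℝ} {x : ℕ → Ω → Fin n → ℝ} {p : Fin 2 → ℕ → Ω → Fin n → ℝ}
  {κ : ℕ}

/-- One-step prediction of the state in the closed loop. -/
theorem hasCondExp_closedLoop (hdw : IsNoise μ D.δ D.N ξ dw) (hsol : D.IsSolution μ ξ dw x p)
    (hd : D.d₂ < D.d₁) (hκ : κ ≤ D.N)
    (hcl : ∀ᵐ ω ∂μ, x (κ + 1) ω = D.rA (dw κ ω) *ᵥ x κ ω
      + ∑ r ∈ Finset.range (D.d₁ - D.d₂ + 1),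
          D.loopCoef S κ r (dw κ ω) *ᵥ (μ[x κ | info ξ dw (D.lag κ r)]) ω)
    {s : ℕ} (hs : s ≤ D.d₁) :
    μ[x (κ + 1) | info ξ dw (D.lag κ s)] =ᵐ[μ] fun ω =>
      D.Ah *ᵥ (μ[x κ | info ξ dw (D.lag κ s)]) ω
      + ∑ r ∈ Finset.range (D.d₁ - D.d₂ + 1), matExp μ (fun ω => D.loopCoef S κ r (dw κ ω)) *ᵥ
          (μ[x κ | info ξ dw (D.lag κ (min s r))]) ω := by
  have hf := hdw.isFresh hκ
  have hlag : info ξ dw (D.lag κ s) ≤ info ξ dw ((κ : ℤ) - 1) := info_mono (D.lag_le κ hs)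
  have h1 := hf.hasCondExp_mulVec hlag D.isAffine_rA.isQuadratic (hsol.adapted κ (by omega))
    (.refl (hsol.integrable_x (by omega : κ ≤ _)))
  simp only [rA, hf.matExp_affine] at h1
  refine ((h1.add (.sum _ fun r hr => hf.hasCondExp_mulVec hlag
    (D.isAffine_loopCoef S κ r).isQuadratic ?_ ?_)).congr hcl .rfl).2 <;>
    rw [Finset.mem_range] at hr
  · exact aestronglyMeasurable_condExp_info (D.lag_le κ (by omega)) _
  · rw [← min_lag]
    have h2 := D.lag_le κ hs
    have h3 := D.lag_le κ (by omega : r ≤ D.d₁)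
    exact hdw.hasCondExp_condExp (by omega) (by omega) _

/-- Replacing `x (κ + 1)` by the closed loop creates products of two coefficients in `dw κ`, hence
the expectations with `P` inside. The estimates of `x (κ + 1)` are already known at `κ - 1` and meet
only the mean of `rA`. -/
theorem HasFeedback.backward_estimate (h : D.HasFeedback S μ ξ dw x p κ)
    (hdw : IsNoise μ D.δ D.N ξ dw) (hsol : D.IsSolution μ ξ dw x p) (hd : D.d₂ < D.d₁)
    (hκ : κ ≤ D.N)
    (hcl : ∀ᵐ ω ∂μ, x (κ + 1) ω = D.rA (dw κ ω) *ᵥ x κ ω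
      + ∑ r ∈ Finset.range (D.d₁ - D.d₂ + 1),
          D.loopCoef S κ r (dw κ ω) *ᵥ (μ[x κ | info ξ dw (D.lag κ r)]) ω) (i : Fin 2) :
    μ[fun ω => (D.rA (dw κ ω))ᵀ *ᵥ p i κ ω | info ξ dw ((κ : ℤ) - 1)] =ᵐ[μ] fun ω =>
      (D.Ahᵀ * S.P i (κ + 1) * D.Ah + D.δ • (D.Abᵀ * S.P i (κ + 1) * D.Ab)) *ᵥ x κ ω
      + ∑ r ∈ Finset.range (D.d₁ - D.d₂ + 1),
          matExp μ (fun ω => (D.rA (dw κ ω))ᵀ * S.P i (κ + 1) * D.loopCoef S κ r (dw κ ω)) *ᵥ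
            (μ[x κ | info ξ dw (D.lag κ r)]) ω
      + ∑ j ∈ Finset.range D.d₁, D.Ahᵀ *ᵥ (S.Ph i (κ + 1) (κ + 1 + j) *ᵥ
          (μ[x (κ + 1) | info ξ dw (D.lag κ (j + 1))]) ω)
      + ∑ j ∈ Finset.range D.d₂, D.Ahᵀ *ᵥ (S.Pc i (κ + 1) (κ + 1 + j) *ᵥ
          (μ[x (κ + 1) | info ξ dw (D.lag κ (D.d₁ - D.d₂ + j + 1))]) ω) := by
  have hf := hdw.isFresh hκ
  have hle : info ξ dw ((κ : ℤ) - 1) ≤ mΩ := hf.le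
  have hAP : IsAffine fun z => (D.rA z)ᵀ * S.P i (κ + 1) :=
    D.isAffine_rA.transpose.mul_const _
  have hx := hsol.adapted κ (by omega)
  have am {s : ℕ} (hs : s ≤ D.d₁) (f : Ω → Fin n → ℝ) :
      AEStronglyMeasurable[info ξ dw ((κ : ℤ) - 1)] (μ[f | info ξ dw (D.lag κ s)]) μ :=
    aestronglyMeasurable_condExp_info (D.lag_le κ hs) f
  have h0 := hf.hasCondExp_mulVec le_rfl (hAP.mul D.isAffine_rA) hx
    (.of_aestronglyMeasurable hle hx (hsol.integrable_x (by omega)))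
  rw [matExp_conj_rA D hf] at h0
  have h1 := HasCondExp.sum (Finset.range (D.d₁ - D.d₂ + 1)) fun r hr =>
    have hr' : r ≤ D.d₁ := by rw [Finset.mem_range] at hr; omega
    hf.hasCondExp_mulVec le_rfl (hAP.mul (D.isAffine_loopCoef S κ r)) (am hr' (x κ))
      (.of_aestronglyMeasurable hle (am hr' _) integrable_condExp)
  have hAt : matExp μ (fun ω => (D.rA (dw κ ω))ᵀ) = D.Ahᵀ := by
    simp only [rA, Matrix.transpose_add, Matrix.transpose_smul, hf.matExp_affine]
  have hc {s : ℕ} (hs : s ≤ D.d₁) (C : Matrix (Fin n) (Fin n) ℝ) :=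
    hf.hasCondExp_mulVec le_rfl D.isAffine_rA.transpose.isQuadratic
      ((am hs (x (κ + 1))).const_mulVec C)
      ((HasCondExp.of_aestronglyMeasurable hle (am hs _) integrable_condExp).mulVec C)
  simp only [hAt] at hc
  have h2 := HasCondExp.sum (Finset.range D.d₁) fun j hj =>
    hc (s := j + 1) (by rw [Finset.mem_range] at hj; omega) (S.Ph i (κ + 1) (κ + 1 + j))
  have h3 := HasCondExp.sum (Finset.range D.d₂) fun j hj =>
    hc (s := D.d₁ - D.d₂ + j + 1) (by rw [Finset.mem_range] at hj; omega)
      (S.Pc i (κ + 1) (κ + 1 + j))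
  refine ((((h0.add h1).add h2).add h3).congr ?_ .rfl).2
  filter_upwards [h i, hcl] with ω hω hx'
  rw [hω]
  nth_rw 1 [hx']
  simp only [Matrix.mulVec_add, Matrix.mulVec_sum, ← Matrix.mulVec_mulVec]

/-- The feedback representation is propagated backwards by one step. -/
theorem HasFeedback.backward (h : D.HasFeedback S μ ξ dw x p κ) (hS : D.IsRiccati S μ dw)
    (hdw : IsNoise μ D.δ D.N ξ dw) (hsol : D.IsSolution μ ξ dw x p) (hd₂ : 0 < D.d₂)
    (hd : D.d₂ < D.d₁) (h1 : D.d₁ ≤ κ) (hκ : κ ≤ D.N)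
    (hcl : ∀ᵐ ω ∂μ, x (κ + 1) ω = D.rA (dw κ ω) *ᵥ x κ ω
      + ∑ r ∈ Finset.range (D.d₁ - D.d₂ + 1),
          D.loopCoef S κ r (dw κ ω) *ᵥ (μ[x κ | info ξ dw (D.lag κ r)]) ω) (i : Fin 2) :
    ∀ᵐ ω ∂μ, p i (κ - 1) ω = S.P i κ *ᵥ x κ ω
      + ∑ j ∈ Finset.range D.d₁, S.Ph i κ (κ + j) *ᵥ (μ[x κ | info ξ dw (D.lag κ j)]) ω
      + ∑ j ∈ Finset.range D.d₂, S.Pc i κ (κ + j) *ᵥ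
          (μ[x κ | info ξ dw (D.lag κ (D.d₁ - D.d₂ + j))]) ω := by
  have hf := hdw.isFresh hκ
  have hpred := ae_all_iff.2 fun s : ℕ => ae_all_iff.2 fun hs : s ≤ D.d₁ =>
    hasCondExp_closedLoop hdw hsol hd hκ hcl hs
  -- Index `d₁` is time `κ - 1`, when `x κ` is known. The top coefficient produced by
  -- `collect_estimates` therefore joins `P`.
  have hxκ : μ[x κ | info ξ dw (D.lag κ D.d₁)] =ᵐ[μ] x κ := by
    rw [show D.lag κ D.d₁ = (κ : ℤ) - 1 by unfold lag; omega]
    exact (HasCondExp.of_aestronglyMeasurable hf.le (hsol.adapted κ (by omega))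
      (hsol.integrable_x (by omega))).2
  have hdd : D.d₁ - D.d₂ + D.d₂ = D.d₁ := by omega
  filter_upwards [hsol.backward i κ (by omega) hκ,
    h.backward_estimate hdw hsol hd hκ hcl i, hpred, hxκ] with ω hb he hp hx
  have key := collect_estimates (d := D.d₁ - D.d₂) (d₂ := D.d₂) (by omega) hd₂ D.Ah
    (fun j => D.Ahᵀ * S.Ph i (κ + 1) (κ + 1 + j)) (fun j => D.Ahᵀ * S.Pc i (κ + 1) (κ + 1 + j))
    (fun r => matExp μ fun ω => (D.rA (dw κ ω))ᵀ * S.P i (κ + 1) * D.loopCoef S κ r (dw κ ω))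
    (fun r => matExp μ fun ω => D.loopCoef S κ r (dw κ ω))
    (fun j => S.Ph i κ (κ + j)) (fun j => S.Pc i κ (κ + j))
    (fun r => (μ[x κ | info ξ dw (D.lag κ r)]) ω)
    (by simpa only [hdd, ← Finset.mul_sum, ← Matrix.mul_add] using! hS.eq_Ph_zero' hf h1 hκ i)
    (fun r hr hr' => by
      simpa only [hdd, ← Finset.mul_sum, ← Matrix.mul_add] using
        hS.eq_Ph_small' hf hd h1 hκ i hr hr')
    (fun r hr hr' => by
      rw [hS.eq_Ph_large i κ r h1 hκ hr (by omega), show κ + 1 + (r - 1) = κ + r by omega])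
    (by simpa only [hdd, ← Finset.mul_sum, ← Matrix.mul_add] using! hS.eq_Pc_zero' hf hd h1 hκ i)
    (fun r hr hr' => by
      rw [hS.eq_Pc i κ r h1 hκ hr hr', show κ + 1 + (r - 1) = κ + r by omega])
  simp only [hdd, hx] at key
  have s1 : ∑ j ∈ Finset.range D.d₁, D.Ahᵀ *ᵥ (S.Ph i (κ + 1) (κ + 1 + j) *ᵥ
        (μ[x (κ + 1) | info ξ dw (D.lag κ (j + 1))]) ω) =
      ∑ j ∈ Finset.range D.d₁, (D.Ahᵀ * S.Ph i (κ + 1) (κ + 1 + j)) *ᵥ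
        (D.Ah *ᵥ (μ[x κ | info ξ dw (D.lag κ (j + 1))]) ω
        + ∑ r ∈ Finset.range (D.d₁ - D.d₂ + 1), matExp μ (fun ω => D.loopCoef S κ r (dw κ ω)) *ᵥ
          (μ[x κ | info ξ dw (D.lag κ (min (j + 1) r))]) ω) := by
    refine Finset.sum_congr rfl fun j hj => ?_
    rw [Finset.mem_range] at hj
    rw [hp (j + 1) hj, Matrix.mulVec_mulVec]
  have s2 : ∑ j ∈ Finset.range D.d₂, D.Ahᵀ *ᵥ (S.Pc i (κ + 1) (κ + 1 + j) *ᵥ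
        (μ[x (κ + 1) | info ξ dw (D.lag κ (D.d₁ - D.d₂ + j + 1))]) ω) =
      ∑ j ∈ Finset.range D.d₂, (D.Ahᵀ * S.Pc i (κ + 1) (κ + 1 + j)) *ᵥ
        (D.Ah *ᵥ (μ[x κ | info ξ dw (D.lag κ (D.d₁ - D.d₂ + j + 1))]) ω
        + ∑ r ∈ Finset.range (D.d₁ - D.d₂ + 1), matExp μ (fun ω => D.loopCoef S κ r (dw κ ω)) *ᵥ
          (μ[x κ | info ξ dw (D.lag κ r)]) ω) := by
    refine Finset.sum_congr rfl fun j hj => ?_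
    rw [Finset.mem_range] at hj
    rw [hp (D.d₁ - D.d₂ + j + 1) (by omega), Matrix.mulVec_mulVec]
    congr 2
    refine Finset.sum_congr rfl fun r hr => ?_
    rw [Finset.mem_range] at hr
    rw [min_eq_right (by omega)]
  rw [hb, he, s1, s2, add_assoc (_ *ᵥ x κ ω), add_assoc (_ *ᵥ x κ ω), key, hS.eq_P i κ h1 hκ,
    show κ + D.d₁ = κ + 1 + (D.d₁ - 1) by omega, show κ + D.d₂ = κ + 1 + (D.d₂ - 1) by omega]
  simp only [Matrix.add_mulVec, Matrix.mul_add, Matrix.add_mul]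
  abel

theorem HasFeedback.pred (h : D.HasFeedback S μ ξ dw x p (κ + 1)) (hS : D.IsRiccati S μ dw)
    (hdw : IsNoise μ D.δ D.N ξ dw) (hsol : D.IsSolution μ ξ dw x p) (hδ : D.δ ≠ 0)
    (hd₂ : 0 < D.d₂) (hd : D.d₂ < D.d₁) (h1 : D.d₁ ≤ κ + 1) (hκ : κ + 1 ≤ D.N)
    (hΓh : IsUnit (D.Gammah S (κ + 2)))
    (hΓ : ∀ m, 1 ≤ m → m < D.d₁ - D.d₂ → IsUnit (D.Gamma S (κ + 2) m))
    (hΓc : IsUnit (D.Gammac S (κ + 2))) : D.HasFeedback S μ ξ dw x p κ := by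
  intro i
  have hcl := h.closedLoop hδ hdw hsol hd hκ hΓh hΓ hΓc
  refine (h.backward hS hdw hsol hd₂ hd h1 hκ ?_ i).mono fun ω hω => ?_
  · filter_upwards [hcl] with ω hω
    rw [hω, sum_loopCoef_mulVec D S hd _ _ fun r => (μ[x (κ + 1) | info ξ dw (D.lag (κ + 1) r)]) ω]
    abel
  -- The same information, counted from `κ` or from `κ + 1`; this explains the index `j + 1` in
  -- `HasFeedback`.
  · have hl (j : ℕ) : D.lag κ (j + 1) = D.lag (κ + 1) j := by unfold lag; omega
    simpa only [hl, Nat.add_sub_cancel] using hω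

end DelayGame

end

/-! ### The main theorem -/

theorem lemma3p4 {n m₁ m₂ : ℕ} (D : DelayGame n m₁ m₂)
    (hR₁ : D.R₁.PosDef) (hR₂ : D.R₂.PosDef)
    (hδ : 0 < D.δ) (hd₂ : 0 < D.d₂) (hd₂₁ : D.d₂ < D.d₁) (hd₁ : D.d₁ < D.N + 1)
    {Ω : Type*} [MeasurableSpace Ω] (μ : Measure Ω) [IsProbabilityMeasure μ]
    (ξ : Ω → Fin n → ℝ) (dw : ℕ → Ω → ℝ) (hdw : IsNoise μ D.δ D.N ξ dw)
    (S : RiccatiFamily n) (hS : D.IsRiccati S μ dw)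
    (hΓh : ∀ k, D.d₁ ≤ k → k ≤ D.N + 1 → IsUnit (D.Gammah S k))
    (hΓ : ∀ k m, D.d₁ ≤ k → k ≤ D.N + 1 → 1 ≤ m → m < D.d₁ - D.d₂ → IsUnit (D.Gamma S k m))
    (hΓc : ∀ k, D.d₁ ≤ k → k ≤ D.N + 1 → IsUnit (D.Gammac S k))
    (x : ℕ → Ω → Fin n → ℝ) (p : Fin 2 → ℕ → Ω → Fin n → ℝ)
    (hsol : D.IsSolution μ ξ dw x p) :
    ∀ k, D.d₁ ≤ k → k ≤ D.N + 1 →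
      (∀ᵐ ω ∂μ, x k ω =
        D.rA (dw (k - 1) ω) *ᵥ x (k - 1) ω
          + D.M S (k - 1) (dw (k - 1) ω) *ᵥ
              (μ[x (k - 1) | info ξ dw ((k : ℤ) - D.d₁ - 2)]) ω
          + ∑ m ∈ Finset.Icc 1 (D.d₁ - D.d₂ - 1),
              D.Mm S (k - 1) m (dw (k - 1) ω) *ᵥ
                (μ[x (k - 1) | info ξ dw ((k : ℤ) - D.d₁ - 2 + m)]) ω
          + D.Hm S (k - 1) (dw (k - 1) ω) *ᵥ
              (μ[x (k - 1) | info ξ dw ((k : ℤ) - D.d₂ - 2)]) ω) ∧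
      (∀ i, ∀ᵐ ω ∂μ, p i (k - 1) ω =
        S.P i k *ᵥ x k ω
          + ∑ j ∈ Finset.range D.d₁,
              S.Ph i k (k + j) *ᵥ (μ[x k | info ξ dw ((k : ℤ) - D.d₁ - 1 + j)]) ω
          + ∑ j ∈ Finset.range D.d₂,
              S.Pc i k (k + j) *ᵥ (μ[x k | info ξ dw ((k : ℤ) - D.d₂ - 1 + j)]) ω) := by
  -- Induction on the distance `r` to the horizon. It stops at `κ + 1 = d₁`, the last index reached
  -- by the Riccati recursions.
  have hfb : ∀ r κ, κ + r = D.N → D.d₁ ≤ κ + 1 → D.HasFeedback S μ ξ dw x p κ := by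
    intro r
    induction r with
    | zero =>
      rintro κ rfl _
      exact DelayGame.hasFeedback_terminal hS hsol
    | succ r ih =>
      intro κ hr hκ
      exact (ih (κ + 1) (by omega) (by omega)).pred hS hdw hsol hδ.ne' hd₂ hd₂₁ hκ (by omega)
        (hΓh _ (by omega) (by omega)) (fun m => hΓ _ m (by omega) (by omega))
        (hΓc _ (by omega) (by omega))
  intro k hk hk'
  obtain ⟨κ, rfl⟩ : ∃ κ, k = κ + 1 := ⟨k - 1, by omega⟩
  have h := hfb (D.N - κ) κ (by omega) hk
  have e1 : ((κ + 1 : ℕ) : ℤ) - D.d₁ - 2 = D.lag κ 0 := by unfold DelayGame.lag; omega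
  have e2 (m : ℕ) : D.lag κ 0 + m = D.lag κ m := by unfold DelayGame.lag; omega
  have e3 : ((κ + 1 : ℕ) : ℤ) - D.d₂ - 2 = D.lag κ (D.d₁ - D.d₂) := by
    unfold DelayGame.lag; omega
  have e4 (j : ℕ) : ((κ + 1 : ℕ) : ℤ) - D.d₁ - 1 + j = D.lag κ (j + 1) := by
    unfold DelayGame.lag; omega
  have e5 (j : ℕ) : ((κ + 1 : ℕ) : ℤ) - D.d₂ - 1 + j = D.lag κ (D.d₁ - D.d₂ + j + 1) := by
    unfold DelayGame.lag; omega
  simp only [e1, e2, e3, e4, e5, Nat.add_sub_cancel]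
  exact ⟨h.closedLoop hδ.ne' hdw hsol hd₂₁ (by omega) (hΓh _ hk hk') (fun m => hΓ _ m hk hk')
    (hΓc _ hk hk'), h⟩
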